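/- **Generalized Doyle–Ericksen formula.** Let $\mathcal B$ be a compact Hausdorff smooth manifold of dimension $n\ge 1$ (with or without boundary) with a mass form $\hat\mu$, i.e. a smooth nowhere vanishing $n$-form, which also orients $\mathcal B$. Let $\mathcal M(\mathcal B)$ be the set of smooth Riemannian metrics on $\mathcal B$, with $T_{\hat g}\mathcal M(\mathcal B)$ the smooth symmetric covariant 2-tensor fields. Let $W\to\mathcal B$ be a smooth vector bundle of finite rank, $U\subseteq W$ open, and let $\mathfrak D$ be the set of smooth sections of $W$ with values in $U$; then $T_{\hat\zeta}\mathfrak D=\Gamma(W)$ and $T^*_{\hat\zeta}\mathfrak D=\Omega^n(\mathcal B;W^*)$, paired by $\langle\beta\,|\,\delta\hat\zeta\rangle=\int_{\mathcal B}\delta\hat\zeta\,\dot\wedge\,\beta$, where $\dot\wedge$ is the wedge product combined with the duality pairing of the values. (For $W=T^*\mathcal B\otimes T\mathcal B$ this is the case of vector-valued 1-forms, where $\Omega^n(\mathcal B;W^*)\cong\Omega^{n-1}(\mathcal B;T^*\mathcal B)$; for $W=S^2T^*\mathcal B$ and $U$ the positive definite elements, $\mathfrak D=\mathcal M(\mathcal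 B)$.) Let $\hat\psi:U\to\mathbb R$ be smooth and let $$\hat\Psi[\hat\zeta]=\int_{\mathcal B}\hat\psi(\hat\zeta)\,\hat\mu .$$ Write $\partial\hat\psi/\partial\hat\zeta$ for the derivative of $\hat\psi$ along the fibres of $W$, and $\hat\star_c\frac{\partial\hat\psi}{\partial\hat\zeta}(\hat\zeta):=\frac{\partial\hat\psi}{\partial\hat\zeta}(\hat\zeta)\otimes\hat\mu\in T^*_{\hat\zeta}\mathfrak D$ for the partial derivative of the top form $\hat\psi(\hat\zeta)\hat\mu$. Let $f:\mathcal M(\mathcal B)\to\mathfrak D$, fix $\hat g\in\mathcal M(\mathcal B)$ and put $\hat\zeta=f(\hat g)$. Assume that $f$ has a tangent map $Tf:T_{\hat g}\mathcal M(\mathcal B)\to T_{\hat\zeta}\mathfrak D$ at $\hat g$: for every curve $t\mapsto\hat g_t$ in $\mathcal M(\mathcal B)$ with $\hat g_0=\hat g$ that is smooth jointly in $t$ and the point of $\mathcal B$, the curve $t\mapsto f(\hat g_t)$ is smooth in the same sense and $\partial_t f(\hat g_t)|_{t=0}=Tf(\partial_t\hat g_t|_{t=0})$. Let $\hat f:=Tf\circ\hat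 g:\Omega^1(\mathcal B;T\mathcal B)\to T_{\hat\zeta}\mathfrak D$, $\hat f(\alpha)=Tf(\mathrm{sym}(\hat g\cdot\alpha))$, and let $\hat f^*:T^*_{\hat\zeta}\mathfrak D\to\Omega^{n-1}(\mathcal B;T^*\mathcal B)$ be its dual, i.e. $\int_{\mathcal B}\hat f(\alpha)\,\dot\wedge\,\beta=\int_{\mathcal B}\alpha\,\dot\wedge\,\hat f^*(\beta)$ for all $\alpha,\beta$. Let $\hat\star_c$ be the complementary Hodge star from $\Omega^1(\mathcal B;T\mathcal B)$ to $\Omega^{n-1}(\mathcal B;T^*\mathcal B)$ determined by $\hat g$ and $\hat\mu$, i.e. $\hat\star_c(a\otimes v)=\iota_{a^\sharp}\hat\mu\otimes v^\flat$ for a 1-form $a$ and a vector field $v$, with $\sharp,\flat$ taken with respect to $\hat g$. Let $\hat\tau\in\Omega^1(\mathcal B;T\mathcal B)$ be smooth and $\hat g$-symmetric. Then the energy balance $$\left.\frac{d}{dt}\right|_{t=0}\hat\Psi[f(\hat g_t)]=\int_{\mathcal B}\hat\varepsilon\,\dot\wedge\,\hat\star_c\hat\tau$$ holds for every smooth curve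 $\hat g_t$ in $\mathcal M(\mathcal B)$ with $\hat g_0=\hat g$, where $\hat\varepsilon$ is the rate of strain given by $\partial_t\hat g_t|_{t=0}=2\,\hat g\cdot\hat\varepsilon$, if and only if $$\hat\tau=2\,\hat\star_c^{-1}\,\hat f^*\!\left(\hat\star_c\frac{\partial\hat\psi}{\partial\hat\zeta}(\hat\zeta)\right).$$ -/

import Mathlib

set_option linter.unusedSectionVars false

open Bundle Manifold ContDiff Module MeasureTheory

noncomputable section

namespace Elasticity

/-! ### Linear algebra on one tangent space -/

section Pointwise

variable {m : ℕ} {V : Type*} [AddCommGroup V] [Module ℝ V] [FiniteDimensional ℝ V]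

lemma curryLeft_injective (μ : V [⋀^Fin (m + 1)]→ₗ[ℝ] ℝ) (hμ : μ ≠ 0)
    (hV : finrank ℝ V = m + 1) : Function.Injective μ.curryLeft := by
  rw [injective_iff_map_eq_zero]
  intro v hv
  by_contra hne
  have hli : LinearIndepOn ℝ id ({v} : Set V) := LinearIndepOn.singleton (R := ℝ) (v := id) hne
  let b := Basis.extend hli
  have : Fintype (hli.extend (Set.subset_univ _)) := FiniteDimensional.fintypeBasisIndex b
  have hvm : v ∈ hli.extend (Set.subset_univ _) := hli.subset_extend _ rfl
  have hcard : Fintype.card (hli.extend (Set.subset_univ _)) = m + 1 := by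
    rw [← hV, finrank_eq_card_basis b]
  let e0 := Fintype.equivFinOfCardEq hcard
  let e := e0.trans (Equiv.swap (e0 ⟨v, hvm⟩) 0)
  let b' := b.reindex e
  have h0 : b' 0 = v := by
    have : e.symm 0 = ⟨v, hvm⟩ := by simp [e]
    simp [b', this, b]
  apply hμ
  rw [← AlternatingMap.map_basis_eq_zero_iff b']
  have h1 := congrArg (fun φ => φ (fun i : Fin m => b' i.succ)) hv
  simp only [AlternatingMap.curryLeft_apply_apply, AlternatingMap.zero_apply] at h1
  rw [← h1]
  congr 1
  funext i
  refine Fin.cases ?_ (fun j => ?_) i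
  · simp [h0]
  · simp

lemma finrank_alternating (hV : finrank ℝ V = m + 1) :
    finrank ℝ V = finrank ℝ (V [⋀^Fin m]→ₗ[ℝ] ℝ) := by
  rw [(exteriorPower.alternatingMapLinearEquiv (R := ℝ) (M := V) (N := ℝ) (n := m)).finrank_eq,
    show finrank ℝ ((⋀[ℝ]^m V) →ₗ[ℝ] ℝ) = finrank ℝ (⋀[ℝ]^m V) from Subspace.dual_finrank_eq,
    exteriorPower.finrank_eq, hV, Nat.choose_succ_self_right]

instance finiteDimensional_alternating : FiniteDimensional ℝ (V [⋀^Fin m]→ₗ[ℝ] ℝ) :=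
  Module.Finite.equiv
    (exteriorPower.alternatingMapLinearEquiv (R := ℝ) (M := V) (N := ℝ) (n := m)).symm

/-- For a volume form `μ` on `V`, the isomorphism `v ↦ ι_v μ = μ(v, ·, …, ·)` of `V` with the
`m`-forms on `V`, where `dim V = m + 1`. -/
def intProd (μ : V [⋀^Fin (m + 1)]→ₗ[ℝ] ℝ) (hμ : μ ≠ 0) (hV : finrank ℝ V = m + 1) :
    V ≃ₗ[ℝ] (V [⋀^Fin m]→ₗ[ℝ] ℝ) :=
  LinearEquiv.ofInjectiveOfFinrankEq μ.curryLeft (curryLeft_injective μ hμ hV)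
    (finrank_alternating hV)

/-- Covector-valued `m`-forms `T(u₁, …, u_m)(w)`, read as linear maps `w ↦ T(·)(w)`. -/
def alternatingFlip (m : ℕ) (V : Type*) [AddCommGroup V] [Module ℝ V] :
    (V [⋀^Fin m]→ₗ[ℝ] Dual ℝ V) ≃ₗ[ℝ] (V →ₗ[ℝ] V [⋀^Fin m]→ₗ[ℝ] ℝ) where
  toFun T :=
    { toFun := fun w => (LinearMap.applyₗ w).compAlternatingMap T
      map_add' := fun w w' => by ext; simp
      map_smul' := fun c w => by ext; simp }
  map_add' T T' := by ext; simp
  map_smul' c T := by ext; simp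
  invFun S :=
    { toFun := fun u =>
        { toFun := fun w => S w u
          map_add' := fun w w' => by simp
          map_smul' := fun c w => by simp }
      map_update_add' := fun u i a b => by ext; simp
      map_update_smul' := fun u i c a => by ext; simp
      map_eq_zero_of_eq' := fun u i j h hij => by
        ext w; exact (S w).map_eq_zero_of_eq u h hij }
  left_inv T := by ext; simp
  right_inv S := by ext; simp

/-- The complementary Hodge star `⋆_c` from vector-valued `1`-forms to covector-valued `m`-forms
on an `(m + 1)`-dimensional space with inner product `b` and mass form `μ`: on decomposable forms
`⋆_c (α ⊗ v) = ι_{α♯} μ ⊗ v♭`; the general formula is `starC_apply`. -/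
def starC (b : LinearMap.BilinForm ℝ V) (hb : b.Nondegenerate)
    (μ : V [⋀^Fin (m + 1)]→ₗ[ℝ] ℝ) (hμ : μ ≠ 0) (hV : finrank ℝ V = m + 1) :
    (V →ₗ[ℝ] V) ≃ₗ[ℝ] (V [⋀^Fin m]→ₗ[ℝ] Dual ℝ V) :=
  LinearEquiv.congrRight (b.toDual hb) ≪≫ₗ LinearMap.lflip ≪≫ₗ
    LinearEquiv.congrRight ((b.toDual hb).symm ≪≫ₗ intProd μ hμ hV) ≪≫ₗ
    (alternatingFlip m V).symm

/-- `(⋆_c τ)(u₁, …, u_m)(w) = μ(v, u₁, …, u_m)`, where the vector `v` represents the covector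
`y ↦ b(τ y, w)`, that is, `v` is the `b`-adjoint of `τ` applied to `w`. -/
lemma starC_apply (b : LinearMap.BilinForm ℝ V) (hb : b.Nondegenerate)
    (μ : V [⋀^Fin (m + 1)]→ₗ[ℝ] ℝ) (hμ : μ ≠ 0) (hV : finrank ℝ V = m + 1)
    (τ : V →ₗ[ℝ] V) (u : Fin m → V) (w : V) :
    starC b hb μ hμ hV τ u w =
      μ (Matrix.vecCons ((b.toDual hb).symm ((LinearMap.compl₁₂ b τ LinearMap.id).flip w)) u) := rfl

/-- The wedge-dot product `ε ∧̇ T` of a vector-valued `1`-form and a covector-valued `m`-form: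
`(ε ∧̇ T)(v₀, …, v_m) = ∑ i, (-1)^i T(v₀, …, v̂_i, …, v_m)(ε v_i)`. -/
def wedgeDot (ε : V →ₗ[ℝ] V) (T : V [⋀^Fin m]→ₗ[ℝ] Dual ℝ V) : V [⋀^Fin (m + 1)]→ₗ[ℝ] ℝ :=
  AlternatingMap.alternatizeUncurryFin (alternatingFlip m V T ∘ₗ ε)

end Pointwise

/-! ### Fields on the body -/

section Body

variable {m : ℕ} {H : Type*} [TopologicalSpace H]
  (I : ModelWithCorners ℝ (EuclideanSpace ℝ (Fin (m + 1))) H)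
  (B : Type*) [TopologicalSpace B] [ChartedSpace H B] [IsManifold I ∞ B]

instance finiteDimensional_tangentSpace (x : B) : FiniteDimensional ℝ (TangentSpace I x) :=
  inferInstanceAs (FiniteDimensional ℝ (EuclideanSpace ℝ (Fin (m + 1))))

lemma finrank_tangentSpace (x : B) : finrank ℝ (TangentSpace I x) = m + 1 := by
  rw [show finrank ℝ (TangentSpace I x) = finrank ℝ (EuclideanSpace ℝ (Fin (m + 1))) from rfl]
  simp

/-- The space of deformations: smooth Riemannian metrics on the body. -/
abbrev Metric : Type _ :=
  ContMDiffRiemannianMetric I ∞ (EuclideanSpace ℝ (Fin (m + 1))) (fun x : B => TangentSpace I x)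

/-- Smooth vector-valued `1`-forms, that is, smooth sections of the bundle `End(TB)`. -/
abbrev VectorOneForm : Type _ :=
  Cₛ^∞⟮I; EuclideanSpace ℝ (Fin (m + 1)) →L[ℝ] EuclideanSpace ℝ (Fin (m + 1)),
    fun x : B => TangentSpace I x →L[ℝ] TangentSpace I x⟯

variable {B}

/-- The value at `x` of the vector field that has the constant components `v` in the
trivialization of the tangent bundle over the preferred chart at `x₀`. -/
def frame (x₀ x : B) (v : EuclideanSpace ℝ (Fin (m + 1))) : TangentSpace I x :=
  (trivializationAt (EuclideanSpace ℝ (Fin (m + 1))) (TangentSpace I) x₀).symm x v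

variable (B)

/-- A mass form: a smooth nowhere vanishing top form. It orients the body. -/
structure MassForm where
  toFun : ∀ x : B, TangentSpace I x [⋀^Fin (m + 1)]→ₗ[ℝ] ℝ
  smooth : ∀ (x₀ : B) (v : Fin (m + 1) → EuclideanSpace ℝ (Fin (m + 1))),
    ContMDiffOn I 𝓘(ℝ, ℝ) ∞ (fun x => toFun x (fun i => frame I x₀ x (v i)))
      (chartAt H x₀).source
  ne_zero : ∀ x, toFun x ≠ 0

/-- Smooth symmetric covariant `2`-tensor fields, that is, symmetric covector-valued `1`-forms:
the tangent space of the space of metrics at each of its points. -/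
@[ext]
structure SymTensor where
  toFun : ∀ x : B, TangentSpace I x →ₗ[ℝ] TangentSpace I x →ₗ[ℝ] ℝ
  symm : ∀ x u w, toFun x u w = toFun x w u
  smooth : ∀ (x₀ : B) (u w : EuclideanSpace ℝ (Fin (m + 1))),
    ContMDiffOn I 𝓘(ℝ, ℝ) ∞ (fun x => toFun x (frame I x₀ x u) (frame I x₀ x w))
      (chartAt H x₀).source

variable {B}

/-- Smooth `k`-forms with values in the dual of a smooth vector bundle `W` with model fibre `F`
(for `W = TB`: covector-valued `k`-forms). Smoothness means smoothness of all components with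
respect to local frames. -/
structure CoForm (k : ℕ) (F : Type*) [NormedAddCommGroup F] [NormedSpace ℝ F] (W : B → Type*)
    [TopologicalSpace (TotalSpace F W)] [∀ x, AddCommGroup (W x)] [∀ x, Module ℝ (W x)]
    [∀ x, TopologicalSpace (W x)] [FiberBundle F W] where
  toFun : ∀ x : B, TangentSpace I x [⋀^Fin k]→ₗ[ℝ] Dual ℝ (W x)
  smooth : ∀ (x₀ : B) (v : Fin k → EuclideanSpace ℝ (Fin (m + 1))) (y : F),
    ContMDiffOn I 𝓘(ℝ, ℝ) ∞
      (fun x => toFun x (fun i => frame I x₀ x (v i)) ((trivializationAt F W x₀).symm x y))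
      ((chartAt H x₀).source ∩ (trivializationAt F W x₀).baseSet)

variable {I}

/-! ### Integration of top forms -/

/-- The integral of a top form over the compact body, oriented by the mass form: the sum over a
smooth partition of unity subordinate to the charts of the integrals in the charts, the sign
comparing the orientation of a chart with that of the mass form. -/
def bodyIntegral [CompactSpace B] [T2Space B] (μ : MassForm I B)
    (η : ∀ x : B, TangentSpace I x [⋀^Fin (m + 1)]→ₗ[ℝ] ℝ) : ℝ :=
  ∑ᶠ c : B, ∫ y in (extChartAt I c).target,
    (Classical.choose (SmoothPartitionOfUnity.exists_isSubordinate_chartAt_source I B)) c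
        ((extChartAt I c).symm y) *
      Real.sign (μ.toFun ((extChartAt I c).symm y)
        (fun j => frame I c ((extChartAt I c).symm y) (EuclideanSpace.single j 1))) *
      η ((extChartAt I c).symm y)
        (fun j => frame I c ((extChartAt I c).symm y) (EuclideanSpace.single j 1))

/-! ### Metrics, strain rates and stresses -/

lemma Metric.nondegenerate (g : Metric I B) (x : B) : (g.inner x).toBilinForm.Nondegenerate := by
  have hpos : ∀ v : TangentSpace I x, (∀ w, g.inner x v w = 0) → v = 0 := fun v hv => by
    by_contra hne
    exact (g.pos x v hne).ne' (hv v)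
  exact ⟨fun v hv => hpos v hv, fun v hv => hpos v fun w => (g.symm x v w).trans (hv w)⟩

/-- The complementary Hodge star at the point `x` of the body, for the metric `g` and the mass
form `μ`. -/
def hodge (g : Metric I B) (μ : MassForm I B) (x : B) :
    (TangentSpace I x →ₗ[ℝ] TangentSpace I x) ≃ₗ[ℝ]
      (TangentSpace I x [⋀^Fin m]→ₗ[ℝ] Dual ℝ (TangentSpace I x)) :=
  starC (g.inner x).toBilinForm (g.nondegenerate x) (μ.toFun x) (μ.ne_zero x)
    (finrank_tangentSpace I B x)

lemma frame_smooth (x₀ : B) (v : EuclideanSpace ℝ (Fin (m + 1))) :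
    ContMDiffOn I (I.prod 𝓘(ℝ, EuclideanSpace ℝ (Fin (m + 1)))) ∞
      (fun x => TotalSpace.mk' (EuclideanSpace ℝ (Fin (m + 1))) x (frame I x₀ x v))
      (chartAt H x₀).source := by
  let e := trivializationAt (EuclideanSpace ℝ (Fin (m + 1))) (TangentSpace I : B → Type _) x₀
  have hb : e.baseSet = (chartAt H x₀).source := rfl
  have h1 : ContMDiffOn I (I.prod 𝓘(ℝ, EuclideanSpace ℝ (Fin (m + 1)))) ∞
      (fun x => e.toOpenPartialHomeomorph.symm (x, v)) e.baseSet :=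
    (e.contMDiffOn_symm (IB := I) (n := ∞)).comp
      (contMDiffOn_id.prodMk contMDiffOn_const) (fun x hx => e.mem_target.2 hx)
  rw [← hb]
  exact h1.congr fun x hx => e.mk_symm hx v

lemma lowerSym_aux (g : Metric I B) (α : VectorOneForm I B) (x₀ : B)
    (u w : EuclideanSpace ℝ (Fin (m + 1))) :
    ContMDiffOn I 𝓘(ℝ, ℝ) ∞
      (fun x => g.inner x (α x (frame I x₀ x u)) (frame I x₀ x w)) (chartAt H x₀).source := by
  intro x hx
  have h1 := (α.contMDiff.contMDiffAt (x := x)).contMDiffWithinAt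
    (s := (chartAt H x₀).source) |>.clm_bundle_apply (frame_smooth x₀ u x hx)
  have h2 : ContMDiffWithinAt I (I.prod 𝓘(ℝ)) ∞ (fun x => TotalSpace.mk' ℝ (E := Bundle.Trivial B ℝ) x
      (g.inner x (α x (frame I x₀ x u)) (frame I x₀ x w))) (chartAt H x₀).source x := by
    apply ContMDiffWithinAt.clm_bundle_apply₂ (F₁ := EuclideanSpace ℝ (Fin (m + 1)))
      (F₂ := EuclideanSpace ℝ (Fin (m + 1)))
    · exact g.contMDiff.contMDiffAt.contMDiffWithinAt
    · exact h1
    · exact frame_smooth x₀ w x hx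
  simp only [contMDiffWithinAt_totalSpace] at h2
  exact h2.2

/-- `sym(g · α)`: lower the vector index of `α` with `g` and symmetrize. -/
def lowerSym (g : Metric I B) (α : VectorOneForm I B) : SymTensor I B where
  toFun x := (2⁻¹ : ℝ) • (((g.inner x).comp (α x)).toBilinForm +
    LinearMap.flip ((g.inner x).comp (α x)).toBilinForm)
  symm x u w := by
    change (2⁻¹ : ℝ) * (g.inner x (α x u) w + g.inner x (α x w) u) =
      2⁻¹ * (g.inner x (α x w) u + g.inner x (α x u) w)
    ring
  smooth x₀ u w := by
    change ContMDiffOn I 𝓘(ℝ, ℝ) ∞ (fun x => (2⁻¹ : ℝ) *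
      (g.inner x (α x (frame I x₀ x u)) (frame I x₀ x w) +
        g.inner x (α x (frame I x₀ x w)) (frame I x₀ x u))) (chartAt H x₀).source
    exact contMDiffOn_const.mul
      ((lowerSym_aux g α x₀ u w).add (lowerSym_aux g α x₀ w u))

/-- A curve of metrics that is smooth jointly in time and in the point of the body. -/
def SmoothMetricCurve (c : ℝ → Metric I B) : Prop :=
  ContMDiff (𝓘(ℝ, ℝ).prod I)
    (I.prod 𝓘(ℝ, EuclideanSpace ℝ (Fin (m + 1)) →L[ℝ] EuclideanSpace ℝ (Fin (m + 1)) →L[ℝ] ℝ)) ∞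
    (fun p : ℝ × B => TotalSpace.mk'
      (EuclideanSpace ℝ (Fin (m + 1)) →L[ℝ] EuclideanSpace ℝ (Fin (m + 1)) →L[ℝ] ℝ)
      (E := fun x : B => TangentSpace I x →L[ℝ] TangentSpace I x →L[ℝ] ℝ)
      p.2 ((c p.1).inner p.2))

/-- `h` is the velocity `∂_t c` at time `0`. -/
def HasVelocity (c : ℝ → Metric I B) (h : SymTensor I B) : Prop :=
  ∀ (x : B) (u w : TangentSpace I x),
    HasDerivAt (fun t => (c t).inner x u w) (h.toFun x u w) 0

/-- `α` is symmetric with respect to `g`, that is, `α` is in the image of `g⁻¹ ∘ sym ∘ g`. -/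
def IsSym (g : Metric I B) (α : VectorOneForm I B) : Prop :=
  ∀ (x : B) (u w : TangentSpace I x), g.inner x (α x u) w = g.inner x (α x w) u

/-! ### Deformation variables and stored energy -/

section Deformation

variable {F : Type*} [NormedAddCommGroup F] [NormedSpace ℝ F] {W : B → Type*}
  [TopologicalSpace (TotalSpace F W)] [∀ x, AddCommGroup (W x)] [∀ x, Module ℝ (W x)]
  [∀ x, TopologicalSpace (W x)] [∀ x, IsTopologicalAddGroup (W x)] [∀ x, ContinuousSMul ℝ (W x)]
  [FiberBundle F W] [VectorBundle ℝ F W] [ContMDiffVectorBundle ∞ F W I]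

/-- The space `𝔇` of deformation variables: the smooth sections of the bundle `W` with values in
the set `U`. For open `U` its tangent space at each point is the space of all smooth sections
of `W`, and its cotangent space consists of the top forms with values in the dual of `W`. -/
def DeformationSpace (I : ModelWithCorners ℝ (EuclideanSpace ℝ (Fin (m + 1))) H)
    [IsManifold I ∞ B] [ContMDiffVectorBundle ∞ F W I] (U : Set (TotalSpace F W)) : Type _ :=
  {ζ : Cₛ^∞⟮I; F, W⟯ // ∀ x : B, TotalSpace.mk' F x (ζ x) ∈ U}

variable {U : Set (TotalSpace F W)}

/-- `Tf` is the tangent map of `f` at `g`: along every smooth curve of metrics through `g` with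
velocity `h`, the deformation variable is a smooth curve with velocity `Tf h`. -/
def IsTangentMap (f : Metric I B → DeformationSpace I U) (g : Metric I B)
    (Tf : SymTensor I B → Cₛ^∞⟮I; F, W⟯) : Prop :=
  ∀ (c : ℝ → Metric I B) (h : SymTensor I B), SmoothMetricCurve c → c 0 = g → HasVelocity c h →
    ContMDiff (𝓘(ℝ, ℝ).prod I) (I.prod 𝓘(ℝ, F)) ∞
      (fun p : ℝ × B => TotalSpace.mk' F p.2 ((f (c p.1)).1 p.2)) ∧
    ∀ x : B, HasDerivAt (fun t => (f (c t)).1 x) (Tf h x) 0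

/-- `f̂ = Tf ∘ ĝ`, as a map on all vector-valued `1`-forms: `α ↦ Tf (sym (g · α))`. -/
def fHat (g : Metric I B) (Tf : SymTensor I B → Cₛ^∞⟮I; F, W⟯) (α : VectorOneForm I B) :
    Cₛ^∞⟮I; F, W⟯ :=
  Tf (lowerSym g α)

/-- The wedge-dot product of a section of `W` and a top form with values in the dual of `W`. -/
def sectionWedge {x : B} (w : W x) (β : TangentSpace I x [⋀^Fin (m + 1)]→ₗ[ℝ] Dual ℝ (W x)) :
    TangentSpace I x [⋀^Fin (m + 1)]→ₗ[ℝ] ℝ :=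
  (LinearMap.applyₗ w).compAlternatingMap β

/-- `fStar` is the dual of `f̂` with respect to the duality pairings `∫ ∧̇`. -/
def IsDual [CompactSpace B] [T2Space B] (μ : MassForm I B) (g : Metric I B)
    (Tf : SymTensor I B → Cₛ^∞⟮I; F, W⟯)
    (fStar : CoForm I (m + 1) F W →
      CoForm I m (EuclideanSpace ℝ (Fin (m + 1))) (fun x : B => TangentSpace I x)) : Prop :=
  ∀ (α : VectorOneForm I B) (β : CoForm I (m + 1) F W),
    bodyIntegral μ (fun x => sectionWedge (fHat g Tf α x) (β.toFun x)) =
      bodyIntegral μ (fun x => wedgeDot (α x).toLinearMap ((fStar β).toFun x))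

/-- The stored energy `Ψ[ζ] = ∫ ψ(ζ) μ`. -/
def storedEnergy [CompactSpace B] [T2Space B] (μ : MassForm I B) (ψ : TotalSpace F W → ℝ)
    (ζ : DeformationSpace I U) : ℝ :=
  bodyIntegral μ (fun x => ψ (TotalSpace.mk' F x (ζ.1 x)) • μ.toFun x)

/-- The derivative of `ψ` along the fibre `W x` at the point `w`, computed in a trivialization. -/
def fibreDeriv (ψ : TotalSpace F W → ℝ) (x : B) (w : W x) : Dual ℝ (W x) :=
  (fderiv ℝ (fun y : F => ψ (TotalSpace.mk' F x ((trivializationAt F W x).symm x y)))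
    (trivializationAt F W x (TotalSpace.mk' F x w)).2).toLinearMap ∘ₗ
    (trivializationAt F W x).linearMapAt ℝ x

lemma fibreDeriv_eq (ψ : TotalSpace F W → ℝ) (x₀ : B) {x : B} (w : W x)
    (hx : x ∈ (trivializationAt F W x₀).baseSet) (y : F) :
    fibreDeriv ψ x w ((trivializationAt F W x₀).symm x y) =
      fderiv ℝ (fun z : F => ψ (TotalSpace.mk' F x ((trivializationAt F W x₀).symm x z)))
        (trivializationAt F W x₀ (TotalSpace.mk' F x w)).2 y := by
  have hx' := mem_baseSet_trivializationAt F W x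
  let e := (trivializationAt F W x).continuousLinearEquivAt ℝ x hx'
  let e₀ := (trivializationAt F W x₀).continuousLinearEquivAt ℝ x hx
  let L : F ≃L[ℝ] F := e.symm.trans e₀
  have h1 : (fun z : F => ψ (TotalSpace.mk' F x ((trivializationAt F W x).symm x z))) =
      (fun z : F => ψ (TotalSpace.mk' F x ((trivializationAt F W x₀).symm x z))) ∘ L := by
    funext z
    have : (trivializationAt F W x₀).symm x (L z) = (trivializationAt F W x).symm x z :=
      e₀.symm_apply_apply (e.symm z)
    simp only [Function.comp, this]
  have h2 : L (trivializationAt F W x (TotalSpace.mk' F x w)).2 =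
      (trivializationAt F W x₀ (TotalSpace.mk' F x w)).2 :=
    congrArg e₀ (e.symm_apply_apply w)
  have h3 : L ((trivializationAt F W x).linearMapAt ℝ x ((trivializationAt F W x₀).symm x y)) = y := by
    rw [Trivialization.coe_linearMapAt_of_mem _ hx']
    exact (congrArg e₀ (e.symm_apply_apply (e₀.symm y))).trans (e₀.apply_symm_apply y)
  simp only [fibreDeriv, LinearMap.comp_apply]
  rw [h1, L.comp_right_fderiv, h2]
  change fderiv ℝ _ _ (L _) = _
  rw [h3]

lemma fibreDeriv_smooth (ψ : TotalSpace F W → ℝ) (hU : IsOpen U)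
    (hψ : ContMDiffOn (I.prod 𝓘(ℝ, F)) 𝓘(ℝ, ℝ) ∞ ψ U) (ζ : DeformationSpace I U)
    (x₀ : B) (y : F) :
    ContMDiffOn I 𝓘(ℝ, ℝ) ∞
      (fun x => fibreDeriv ψ x (ζ.1 x) ((trivializationAt F W x₀).symm x y))
      (trivializationAt F W x₀).baseSet := by
  let e := trivializationAt F W x₀
  intro x hx
  have hζ : ContMDiffAt I 𝓘(ℝ, F) ∞ (fun x => (e (TotalSpace.mk' F x (ζ.1 x))).2) x :=
    ((e.contMDiffAt_iff (IB := I) (n := ∞) (f := fun x => TotalSpace.mk' F x (ζ.1 x))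
      (e.mem_source.2 hx)).1 (ζ.1.contMDiff.contMDiffAt)).2
  have hmem : ((x, (e (TotalSpace.mk' F x (ζ.1 x))).2) : B × F) ∈ e.target := e.mem_target.2 hx
  have hback : e.toOpenPartialHomeomorph.symm (x, (e (TotalSpace.mk' F x (ζ.1 x))).2) =
      TotalSpace.mk' F x (ζ.1 x) :=
    e.symm_apply_mk_proj (x := TotalSpace.mk' F x (ζ.1 x)) (e.mem_source.2 hx)
  have hΦ0 : ContMDiffAt (I.prod 𝓘(ℝ, F)) 𝓘(ℝ, ℝ) ∞
      (fun p : B × F => ψ (e.toOpenPartialHomeomorph.symm p))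
      (x, (e (TotalSpace.mk' F x (ζ.1 x))).2) := by
    refine ContMDiffAt.comp _ ?_ ((e.contMDiffOn_symm (IB := I) (n := ∞)).contMDiffAt
      (e.open_target.mem_nhds hmem))
    rw [hback]
    exact hψ.contMDiffAt (hU.mem_nhds (ζ.2 x))
  have hΦ : ContMDiffAt (I.prod 𝓘(ℝ, F)) 𝓘(ℝ, ℝ) ∞
      (Function.uncurry fun (x : B) (z : F) => ψ (TotalSpace.mk' F x (e.symm x z)))
      (x, (e (TotalSpace.mk' F x (ζ.1 x))).2) := by
    refine hΦ0.congr_of_eventuallyEq ?_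
    filter_upwards [e.open_target.mem_nhds hmem] with p hp
    have := e.mk_symm (e.mem_target.1 hp) p.2
    exact congrArg ψ this
  have h1 := ContMDiffAt.mfderiv (I := 𝓘(ℝ, F)) (I' := 𝓘(ℝ, ℝ)) (m := ∞) (n := ∞)
    (fun (x : B) (z : F) => ψ (TotalSpace.mk' F x (e.symm x z))) _ hΦ hζ (by simp)
  have h1' : ContMDiffAt I 𝓘(ℝ, F →L[ℝ] ℝ) ∞ (fun x' : B =>
      (fderiv ℝ (fun z : F => ψ (TotalSpace.mk' F x' (e.symm x' z)))
        (e (TotalSpace.mk' F x' (ζ.1 x'))).2 : F →L[ℝ] ℝ)) x := by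
    refine h1.congr_of_eventuallyEq (Filter.Eventually.of_forall fun x' => ?_)
    have h3 := congrFun (inTangentCoordinates_model_space (I := 𝓘(ℝ, F)) (I' := 𝓘(ℝ, ℝ))
      (fun x => (e (TotalSpace.mk' F x (ζ.1 x))).2)
      (fun x => ψ (TotalSpace.mk' F x (e.symm x (e (TotalSpace.mk' F x (ζ.1 x))).2)))
      (fun x => (mfderiv 𝓘(ℝ, F) 𝓘(ℝ, ℝ) (fun z : F => ψ (TotalSpace.mk' F x (e.symm x z)))
        (e (TotalSpace.mk' F x (ζ.1 x))).2 : F →L[ℝ] ℝ)) x) x'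
    refine Eq.trans ?_ h3.symm
    rw [mfderiv_eq_fderiv]
  have h2 := h1'.clm_apply (contMDiffAt_const (c := y))
  refine (ContMDiffAt.congr_of_eventuallyEq (h2) ?_).contMDiffWithinAt
  filter_upwards [e.open_baseSet.mem_nhds hx] with x' hx'
  exact fibreDeriv_eq ψ x₀ _ hx' y

/-- `⋆_c ∂ψ/∂ζ`, the partial derivative of the top form `ψ(ζ) μ`: the top form `∂ψ/∂ζ ⊗ μ` with
values in the dual of `W`. (For any fibre metric on `W` it is the complementary Hodge star of the
fibre gradient of `ψ`.) -/
def starPartial (μ : MassForm I B) (ψ : TotalSpace F W → ℝ) (hU : IsOpen U)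
    (hψ : ContMDiffOn (I.prod 𝓘(ℝ, F)) 𝓘(ℝ, ℝ) ∞ ψ U) (ζ : DeformationSpace I U) :
    CoForm I (m + 1) F W where
  toFun x := (LinearMap.toSpanSingleton ℝ (Dual ℝ (W x))
    (fibreDeriv ψ x (ζ.1 x))).compAlternatingMap (μ.toFun x)
  smooth x₀ v y := by
    change ContMDiffOn I 𝓘(ℝ, ℝ) ∞ (fun x => μ.toFun x (fun i => frame I x₀ x (v i)) *
      fibreDeriv ψ x (ζ.1 x) ((trivializationAt F W x₀).symm x y)) _
    exact ((μ.smooth x₀ v).mono Set.inter_subset_left).mul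
      ((fibreDeriv_smooth ψ hU hψ ζ x₀ y).mono Set.inter_subset_right)

/-- The energy balance at the state `g`: along every smooth motion through `g` whose strain rate
`ε` is given by `∂_t g = 2 g · ε`, the stored energy changes at the rate `∫ ε ∧̇ ⋆_c τ`. -/
def EnergyBalance [CompactSpace B] [T2Space B] (μ : MassForm I B) (ψ : TotalSpace F W → ℝ)
    (f : Metric I B → DeformationSpace I U) (g : Metric I B) (τ : VectorOneForm I B) : Prop :=
  ∀ (c : ℝ → Metric I B) (ε : VectorOneForm I B), SmoothMetricCurve c → c 0 = g →
    (∀ (x : B) (u w : TangentSpace I x),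
      HasDerivAt (fun t => (c t).inner x u w) (2 * g.inner x (ε x u) w) 0) →
    HasDerivAt (fun t => storedEnergy μ ψ (f (c t)))
      (bodyIntegral μ (fun x => wedgeDot (ε x).toLinearMap (hodge g μ x (τ x).toLinearMap))) 0

end Deformation

end Body

end Elasticity

end

noncomputable section

namespace Elasticity

/-! ### Pointwise algebra of the wedge-dot product and the complementary Hodge star. -/

section Algebra

variable {m : ℕ} {V : Type*} [AddCommGroup V] [Module ℝ V]

/-! Let `β` be the top form `starPartial μ ψ hU hψ (f g)`. Differentiating under the integral and
applying the chain rule in each fibre, the energy along a motion with velocity `h` changes at the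
rate `∫ Tf h ∧̇ β` (`hasDerivAt_storedEnergy`). If `h = 2 g · ε`, then `ε` is automatically
`g`-symmetric, so `h = sym(g · 2ε)` and duality turns the rate into `∫ ε ∧̇ 2 fStar β`
(`hasDerivAt_storedEnergy_strain`). The balance therefore says that `⋆_c τ` and `2 fStar β` have the
same integral against every strain rate that some motion realizes. One implication is then
immediate.

For the other, put `σ = ⋆_c⁻¹ (fStar β)`. The pointwise identity `(g(a, ·) b) ∧̇ ⋆_c τ = g(τ a, b)
μ` (`wedgeDot_starC_rankOne`) makes rank-one fields the right test fields. Each `χ g(a, ·) a` is the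
strain rate of an explicit curve of metrics (`exists_curve`), and localizing with the bump function
`χ` (`eq_of_bodyIntegral_eq`) gives `g(τ a, a) = 2 g(σ a, a)`. This determines symmetric parts only.
The symmetry of `σ` comes from the dual: a `g`-antisymmetric `α` has `sym(g · α) = 0`, which is the
velocity of the constant curve, so `∫ α ∧̇ fStar β = 0`. Polarization then yields `τ = 2 σ`.

The analysis rests on `exists_measure_bodyIntegral`, which replaces the integral over charts by a
finite measure positive on open sets. Linearity of `Tf` is never needed: only its values on
velocities of curves enter. -/

lemma wedgeDot_apply (ε : V →ₗ[ℝ] V) (T : V [⋀^Fin m]→ₗ[ℝ] Dual ℝ V) (v : Fin (m + 1) → V) :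
    wedgeDot ε T v = ∑ i : Fin (m + 1), (-1) ^ (i : ℕ) * T (i.removeNth v) (ε (v i)) := by
  simp only [wedgeDot, AlternatingMap.alternatizeUncurryFin_apply, LinearMap.comp_apply,
    alternatingFlip, zsmul_eq_mul]
  refine Finset.sum_congr rfl fun i _ => ?_
  push_cast
  rfl

/-- The `(m + 2)`-form `φ ∧ μ` vanishes because `dim V = m + 1`. Expanding it on `(s, v₀, …, v_m)`
isolates the term `φ s * μ v`; the remaining terms are the sum, with the opposite sign. -/
lemma sum_mul_interior [FiniteDimensional ℝ V] (hV : finrank ℝ V = m + 1) (φ : V →ₗ[ℝ] ℝ)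
    (μ : V [⋀^Fin (m + 1)]→ₗ[ℝ] ℝ) (s : V) (v : Fin (m + 1) → V) :
    ∑ i : Fin (m + 1), (-1) ^ (i : ℕ) * (φ (v i) * μ (Matrix.vecCons s (i.removeNth v))) =
      φ s * μ v := by
  have h0 := (AlternatingMap.alternatizeUncurryFin (φ.smulRight μ)).map_linearDependent
    (Matrix.vecCons s v) (fun hli => by
      have := hli.fintype_card_le_finrank
      simp [hV] at this)
  rw [AlternatingMap.alternatizeUncurryFin_apply, Fin.sum_univ_succ] at h0
  have h1 : ∀ i : Fin (m + 1), i.succ.removeNth (Matrix.vecCons s v) =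
      Matrix.vecCons s (i.removeNth v) := fun i => by
    funext j
    refine Fin.cases ?_ (fun j => ?_) j
    · simp [Fin.removeNth_apply]
    · simp [Fin.removeNth_apply]
  have h2 : (0 : Fin (m + 2)).removeNth (Matrix.vecCons s v) = v := by
    funext j; simp [Fin.removeNth_apply]
  simp only [h1, h2, LinearMap.smulRight_apply, AlternatingMap.smul_apply, smul_eq_mul,
    Matrix.cons_val_succ, Matrix.cons_val_zero, Fin.val_succ, Fin.val_zero, pow_zero, one_smul,
    pow_succ, mul_neg, mul_one, zsmul_eq_mul, Int.cast_neg, neg_mul, Finset.sum_neg_distrib] at h0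
  push_cast at h0
  linarith

/-- With `s` the vector representing `y ↦ b (τ y) d`, the left side is `b a ∧ ι_s μ`. By
`sum_mul_interior` this is `b a s • μ`, and `b a s = b (τ a) d` by the choice of `s`. -/
lemma wedgeDot_starC_rankOne [FiniteDimensional ℝ V] (b : LinearMap.BilinForm ℝ V)
    (hb : b.Nondegenerate) (hs : ∀ u w, b u w = b w u) (μ : V [⋀^Fin (m + 1)]→ₗ[ℝ] ℝ) (hμ : μ ≠ 0)
    (hV : finrank ℝ V = m + 1) (τ : V →ₗ[ℝ] V) (a d : V) :
    wedgeDot ((b a).smulRight d) (starC b hb μ hμ hV τ) = b (τ a) d • μ := by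
  ext v
  set s := (b.toDual hb).symm ((LinearMap.compl₁₂ b τ LinearMap.id).flip d) with hsdef
  have h1 : b a s = b (τ a) d := by
    rw [hs a s]
    exact LinearMap.BilinForm.apply_toDual_symm_apply (hB := hb)
      ((LinearMap.compl₁₂ b τ LinearMap.id).flip d) a
  rw [wedgeDot_apply, AlternatingMap.smul_apply, smul_eq_mul, ← h1,
    ← sum_mul_interior hV (b a) μ s v]
  refine Finset.sum_congr rfl fun i _ => ?_
  rw [LinearMap.smulRight_apply, map_smul, smul_eq_mul, starC_apply]

lemma wedgeDot_add_left (ε ε' : V →ₗ[ℝ] V) (T : V [⋀^Fin m]→ₗ[ℝ] Dual ℝ V) :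
    wedgeDot (ε + ε') T = wedgeDot ε T + wedgeDot ε' T := by
  ext v
  simp [wedgeDot_apply, mul_add, Finset.sum_add_distrib]

lemma wedgeDot_smul_left (c : ℝ) (ε : V →ₗ[ℝ] V) (T : V [⋀^Fin m]→ₗ[ℝ] Dual ℝ V) :
    wedgeDot (c • ε) T = c • wedgeDot ε T := by
  ext v
  simp only [wedgeDot_apply, LinearMap.smul_apply, map_smul, smul_eq_mul,
    AlternatingMap.smul_apply, Finset.mul_sum]
  exact Finset.sum_congr rfl fun i _ => by ring

lemma wedgeDot_smul_right (c : ℝ) (ε : V →ₗ[ℝ] V) (T : V [⋀^Fin m]→ₗ[ℝ] Dual ℝ V) :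
    wedgeDot ε (c • T) = c • wedgeDot ε T := by
  ext v
  simp only [wedgeDot_apply, LinearMap.smul_apply, smul_eq_mul,
    AlternatingMap.smul_apply, Finset.mul_sum]
  exact Finset.sum_congr rfl fun i _ => by ring

end Algebra

/-! ### Measures given by a density in one chart, boundary included. -/

section ChartMeasure

open Set Topology

variable {E : Type*} [NormedAddCommGroup E] [NormedSpace ℝ E] [FiniteDimensional ℝ E]
  [MeasurableSpace E] [BorelSpace E] {H : Type*} [TopologicalSpace H] (I : ModelWithCorners ℝ E H)
  {B : Type*} [TopologicalSpace B] [ChartedSpace H B]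

lemma measurableSet_extChartAt_target (c : B) : MeasurableSet (extChartAt I c).target := by
  rw [extChartAt_target]
  exact ((chartAt H c).open_target.preimage I.continuous_symm).measurableSet.inter
    I.isClosed_range.measurableSet

/-- The measure on a manifold with density `w` in the extended chart at `c`. -/
def chartMeasure [MeasurableSpace B] (ν : Measure E) (c : B) (w : B → ℝ) : Measure B :=
  Measure.map (extChartAt I c).symm
    ((ν.restrict (extChartAt I c).target).withDensity
      fun y => ENNReal.ofReal (w ((extChartAt I c).symm y)))

variable (ν : Measure E) {c : B} {w : B → ℝ}

lemma continuousOn_comp_extChartAt_symm {X : Type*} [TopologicalSpace X] {w : B → X}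
    (hw : Continuous w) : ContinuousOn (fun y => w ((extChartAt I c).symm y))
      (extChartAt I c).target :=
  hw.comp_continuousOn (continuousOn_extChartAt_symm c)

/-- The support of `w` is compact and is carried by the chart to a compact subset of the target, off
which the integrand vanishes. -/
lemma integrableOn_comp_extChartAt_symm [IsFiniteMeasureOnCompacts ν] [CompactSpace B]
    (hw : Continuous w) (hsupp : tsupport w ⊆ (chartAt H c).source) :
    IntegrableOn (fun y => w ((extChartAt I c).symm y)) (extChartAt I c).target ν := by
  have hK : IsCompact (extChartAt I c '' tsupport w) :=
    (isClosed_tsupport w).isCompact.image_of_continuousOn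
      ((continuousOn_extChartAt c).mono (by rwa [extChartAt_source]))
  have hKt : extChartAt I c '' tsupport w ⊆ (extChartAt I c).target := by
    rintro _ ⟨x, hx, rfl⟩
    exact (extChartAt I c).map_source (by rw [extChartAt_source]; exact hsupp hx)
  refine (((continuousOn_comp_extChartAt_symm I hw).mono hKt).integrableOn_compact
    hK).of_forall_sdiff_eq_zero (measurableSet_extChartAt_target I c) fun y hy => ?_
  by_contra hne
  exact hy.2 ⟨_, subset_tsupport _ hne, (extChartAt I c).right_inv hy.1⟩

variable [MeasurableSpace B] [BorelSpace B]

lemma aemeasurable_extChartAt_symm (f : E → ENNReal) : AEMeasurable (extChartAt I c).symm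
    ((ν.restrict (extChartAt I c).target).withDensity f) :=
  ((continuousOn_extChartAt_symm c).aemeasurable
    (measurableSet_extChartAt_target I c)).mono_ac (withDensity_absolutelyContinuous _ _)

lemma isFiniteMeasure_chartMeasure [IsFiniteMeasureOnCompacts ν] [CompactSpace B]
    (hw : Continuous w) (hsupp : tsupport w ⊆ (chartAt H c).source) :
    IsFiniteMeasure (chartMeasure I ν c w) := by
  have := isFiniteMeasure_withDensity_ofReal
    (integrableOn_comp_extChartAt_symm I ν hw hsupp).2
  exact Measure.isFiniteMeasure_map _ _

lemma integral_chartMeasure (hw : Continuous w) (hw0 : 0 ≤ w) {φ : B → ℝ} (hφ : Continuous φ) :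
    ∫ x, φ x ∂chartMeasure I ν c w =
      ∫ y in (extChartAt I c).target, w ((extChartAt I c).symm y) * φ ((extChartAt I c).symm y)
        ∂ν := by
  rw [chartMeasure, integral_map (aemeasurable_extChartAt_symm I ν _)
    hφ.aestronglyMeasurable, integral_withDensity_eq_integral_toReal_smul₀
      (((continuousOn_comp_extChartAt_symm I hw).aemeasurable
        (measurableSet_extChartAt_target I c)).ennreal_ofReal) (by simp)]
  simp only [ENNReal.toReal_ofReal (hw0 _), smul_eq_mul]

/-- The set `O` may meet the boundary, where its chart image is only relatively open in `range I`.
Since `range I` lies in the closure of its interior, that image still contains a nonempty open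
subset of `E`. -/
lemma chartMeasure_pos [ν.IsOpenPosMeasure] (hw : Continuous w) {O : Set B} (hO : IsOpen O)
    (hOs : O ⊆ (chartAt H c).source) (hwO : ∀ x ∈ O, 0 < w x) (hne : O.Nonempty) :
    chartMeasure I ν c w O ≠ 0 := by
  obtain ⟨x, hx⟩ := hne
  have hxs : x ∈ (extChartAt I c).source := by rw [extChartAt_source]; exact hOs hx
  have hA : (extChartAt I c).target ∩ (extChartAt I c).symm ⁻¹' O ∈
      𝓝[range I] (extChartAt I c x) := by
    refine Filter.inter_mem (extChartAt_target_mem_nhdsWithin' hxs) ?_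
    refine mem_nhdsWithin_of_mem_nhds ((continuousAt_extChartAt_symm' hxs).preimage_mem_nhds ?_)
    rw [(extChartAt I c).left_inv hxs]
    exact hO.mem_nhds hx
  obtain ⟨u, hu, hxu, huA⟩ := mem_nhdsWithin.1 hA
  have hmem : extChartAt I c x ∈ closure (interior (range I)) :=
    I.range_subset_closure_interior
      (extChartAt_target_subset_range c ((extChartAt I c).map_source hxs))
  have hv : (u ∩ interior (range I)).Nonempty := mem_closure_iff.1 hmem u hu hxu
  have hvA : u ∩ interior (range I) ⊆
      (extChartAt I c).target ∩ (extChartAt I c).symm ⁻¹' O :=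
    fun y hy => huA ⟨hy.1, interior_subset hy.2⟩
  intro h0
  rw [chartMeasure, Measure.map_apply_of_aemeasurable (aemeasurable_extChartAt_symm I ν _)
    hO.measurableSet, withDensity_apply_eq_zero'
      (((continuousOn_comp_extChartAt_symm I hw).aemeasurable
        (measurableSet_extChartAt_target I c)).ennreal_ofReal),
    Measure.restrict_apply' (measurableSet_extChartAt_target I c)] at h0
  refine ((hu.inter isOpen_interior).measure_pos ν hv).ne' (measure_mono_null ?_ h0)
  intro y hy
  refine ⟨⟨?_, (hvA hy).2⟩, (hvA hy).1⟩
  exact (ENNReal.ofReal_pos.2 (hwO _ (hvA hy).2)).ne'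

end ChartMeasure

lemma sign_mul_eq_abs (r : ℝ) : Real.sign r * r = |r| := by
  rcases lt_trichotomy r 0 with h | rfl | h
  · rw [Real.sign_of_neg h, abs_of_neg h, neg_one_mul]
  · simp
  · rw [Real.sign_of_pos h, abs_of_pos h, one_mul]

/-! ### The integral over the body as integration against a measure. -/

section BodyMeasure

open Set Topology

variable {m : ℕ} {H : Type*} [TopologicalSpace H]
  {I : ModelWithCorners ℝ (EuclideanSpace ℝ (Fin (m + 1))) H}
  {B : Type*} [TopologicalSpace B] [ChartedSpace H B] [IsManifold I ∞ B]

lemma frame_eq_symmL {x₀ x : B} (hx : x ∈ (chartAt H x₀).source)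
    (v : EuclideanSpace ℝ (Fin (m + 1))) :
    frame I x₀ x v = ((trivializationAt (EuclideanSpace ℝ (Fin (m + 1)))
      (TangentSpace I : B → Type _) x₀).continuousLinearEquivAt ℝ x hx).symm v := rfl

/-- The values at `x` of the frame fields of the chart at `x₀`, as a basis. -/
def frameBasis (I : ModelWithCorners ℝ (EuclideanSpace ℝ (Fin (m + 1))) H) [IsManifold I ∞ B]
    {x₀ x : B} (hx : x ∈ (chartAt H x₀).source) :
    Basis (Fin (m + 1)) ℝ (TangentSpace I x) :=
  (EuclideanSpace.basisFun (Fin (m + 1)) ℝ).toBasis.map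
    ((trivializationAt (EuclideanSpace ℝ (Fin (m + 1)))
      (TangentSpace I : B → Type _) x₀).continuousLinearEquivAt ℝ x hx).symm.toLinearEquiv

lemma frameBasis_apply {x₀ x : B} (hx : x ∈ (chartAt H x₀).source) (j : Fin (m + 1)) :
    frameBasis I hx j = frame I x₀ x (EuclideanSpace.single j 1) := by
  rw [frameBasis, Basis.map_apply, frame_eq_symmL hx]
  simp

/-- The component of the mass form with respect to the frame fields of the chart at `c`. -/
def MassForm.comp (μ : MassForm I B) (c x : B) : ℝ :=
  μ.toFun x (fun j => frame I c x (EuclideanSpace.single j 1))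

lemma MassForm.comp_ne_zero (μ : MassForm I B) {c x : B} (hx : x ∈ (chartAt H c).source) :
    μ.comp c x ≠ 0 := by
  have h := (AlternatingMap.map_basis_ne_zero_iff (frameBasis I hx) (μ.toFun x)).2 (μ.ne_zero x)
  simpa only [MassForm.comp, ← frameBasis_apply hx] using! h

lemma MassForm.continuousOn_comp (μ : MassForm I B) (c : B) :
    ContinuousOn (μ.comp c) (chartAt H c).source :=
  (μ.smooth c fun j => EuclideanSpace.single j 1).continuousOn

lemma continuous_of_continuousOn_tsupport {X Y : Type*} [TopologicalSpace X] [TopologicalSpace Y]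
    [Zero Y] {f : X → Y} {s : Set X} (hs : IsOpen s) (hf : ContinuousOn f s)
    (hsupp : tsupport f ⊆ s) : Continuous f :=
  continuous_of_tsupport fun _ hx => hf.continuousAt (hs.mem_nhds (hsupp hx))

variable [CompactSpace B] [T2Space B]

/-- Integration of top forms over the body is, for continuous multiples of the mass form,
integration with respect to a finite measure that is positive on open sets. -/
lemma exists_measure_bodyIntegral [MeasurableSpace B] [BorelSpace B] (μ : MassForm I B) :
    ∃ ν : Measure B, IsFiniteMeasure ν ∧ ν.IsOpenPosMeasure ∧
      ∀ φ : B → ℝ, Continuous φ → bodyIntegral μ (fun x => φ x • μ.toFun x) = ∫ x, φ x ∂ν := by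
  set ρ := Classical.choose (SmoothPartitionOfUnity.exists_isSubordinate_chartAt_source I B)
    with hρdef
  have hρ : ρ.IsSubordinate fun x => (chartAt H x).source :=
    Classical.choose_spec (SmoothPartitionOfUnity.exists_isSubordinate_chartAt_source I B)
  -- Against a multiple of `μ`, the orientation sign and the component of `μ` combine to an absolute
  -- value, so each chart contributes a nonnegative density.
  let w : B → B → ℝ := fun c x => ρ c x * |μ.comp c x|
  have hwts : ∀ c, tsupport (w c) ⊆ (chartAt H c).source := fun c =>
    (closure_mono (Function.support_mul_subset_left _ _)).trans (hρ c)
  have hw0 : ∀ c, 0 ≤ w c := fun c x => mul_nonneg (ρ.nonneg c x) (abs_nonneg _)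
  have hwc : ∀ c, Continuous (w c) := fun c =>
    continuous_of_continuousOn_tsupport (chartAt H c).open_source
      ((ρ c).contMDiff.continuous.continuousOn.mul (μ.continuousOn_comp c).abs) (hwts c)
  have hfin : {c | (Function.support (ρ c)).Nonempty}.Finite :=
    ρ.locallyFinite.finite_nonempty_of_compact
  let S := hfin.toFinset
  have hS : ∀ c, c ∉ S → ∀ x, ρ c x = 0 := fun c hc x => by
    by_contra hne
    exact hc (hfin.mem_toFinset.2 ⟨x, hne⟩)
  have hfinm : ∀ c, IsFiniteMeasure (chartMeasure I volume c (w c)) := fun c =>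
    isFiniteMeasure_chartMeasure I volume (hwc c) (hwts c)
  refine ⟨∑ c ∈ S, chartMeasure I volume c (w c), inferInstance, ⟨fun O hO hne h0 => ?_⟩,
    fun φ hφ => ?_⟩
  · obtain ⟨x, hx⟩ := hne
    obtain ⟨c, hc⟩ := ρ.exists_pos_of_mem (mem_univ x)
    have hcS : c ∈ S := by
      by_contra hcS
      exact hc.ne' (hS c hcS x)
    rw [Measure.finsetSum_apply, Finset.sum_eq_zero_iff] at h0
    have hpos : IsOpen (O ∩ {x | 0 < ρ c x}) :=
      hO.inter (isOpen_lt continuous_const (ρ c).contMDiff.continuous)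
    have hsrc : O ∩ {x | 0 < ρ c x} ⊆ (chartAt H c).source := fun y hy =>
      hρ c (subset_tsupport _ (ne_of_gt hy.2))
    exact chartMeasure_pos I volume (hwc c) hpos hsrc
      (fun y hy => mul_pos hy.2 (abs_pos.2 (μ.comp_ne_zero (hsrc hy)))) ⟨x, hx, hc⟩
      (measure_mono_null inter_subset_left (h0 c hcS))
  · rw [integral_finsetSum_measure fun c _ => (hφ.integrable_of_hasCompactSupport
      (HasCompactSupport.of_compactSpace φ)), bodyIntegral, finsum_eq_sum_of_support_subset]
    · refine Finset.sum_congr rfl fun c _ => ?_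
      rw [integral_chartMeasure I volume (hwc c) (hw0 c) hφ]
      refine setIntegral_congr_fun (measurableSet_extChartAt_target I c) fun y _ => ?_
      change _ * Real.sign (μ.comp c _) * (_ * μ.comp c _) = _ * |μ.comp c _| * _
      rw [← sign_mul_eq_abs]
      ring
    · intro c hc
      by_contra hcS
      refine hc ?_
      simp only [← hρdef, hS c hcS, zero_mul, integral_zero]

end BodyMeasure

/-! ### Differentiation under the integral sign. -/

section ParametricIntegral

open Set Topology

/-- Needed for curves in a fibre of `W`, which has a vector space topology but no norm. The proof
uses the definition of the derivative by little-o in topological vector spaces. -/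
lemma hasDerivAt_clm_comp {X Y : Type*} [AddCommGroup X] [Module ℝ X] [TopologicalSpace X]
    [IsTopologicalAddGroup X] [ContinuousSMul ℝ X] [NormedAddCommGroup Y] [NormedSpace ℝ Y]
    (L : X →L[ℝ] Y) {γ : ℝ → X} {v : X} {t : ℝ} (h : HasDerivAt γ v t) :
    HasDerivAt (fun s => L (γ s)) (L v) t := by
  refine HasFDerivAt.of_isLittleOTVS ?_
  have h1 := (L.isBigOTVS_fun_comp).trans_isLittleOTVS
    (HasFDerivAt.isLittleOTVS h)
  simpa using! h1

variable {E : Type*} [NormedAddCommGroup E] [NormedSpace ℝ E] {H : Type*} [TopologicalSpace H]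
  {I : ModelWithCorners ℝ E H} {B : Type*} [TopologicalSpace B] [ChartedSpace H B]
  {Φ : ℝ × B → ℝ}

lemma hasDerivAt_slice (hΦ : ContMDiff (𝓘(ℝ, ℝ).prod I) 𝓘(ℝ, ℝ) ∞ Φ) (t : ℝ) (x : B) :
    HasDerivAt (fun s => Φ (s, x)) (deriv (fun s => Φ (s, x)) t) t := by
  have h : ContMDiff 𝓘(ℝ, ℝ) 𝓘(ℝ, ℝ) ∞ fun s => Φ (s, x) :=
    hΦ.comp (contMDiff_id.prodMk contMDiff_const)
  exact ((contMDiff_iff_contDiff.1 h).differentiable (by simp)).differentiableAt.hasDerivAt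

lemma continuous_deriv_slice [IsManifold I ∞ B]
    (hΦ : ContMDiff (𝓘(ℝ, ℝ).prod I) 𝓘(ℝ, ℝ) ∞ Φ) :
    Continuous fun p : ℝ × B => deriv (fun s => Φ (s, p.2)) p.1 := by
  rw [continuous_iff_continuousAt]
  intro p
  -- The time `s` is detached from the parameter `q = (t, x)`, so that the derivative in `s` at `s =
  -- t` depends smoothly on `q`.
  have h0 : ContMDiffAt ((𝓘(ℝ, ℝ).prod I).prod 𝓘(ℝ, ℝ)) 𝓘(ℝ, ℝ) ∞
      (Function.uncurry fun (q : ℝ × B) (s : ℝ) => Φ (s, q.2)) (p, p.1) :=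
    (hΦ.comp (contMDiff_snd.prodMk (contMDiff_snd.comp contMDiff_fst))) _
  have h1 := ContMDiffAt.mfderiv (I := 𝓘(ℝ, ℝ)) (I' := 𝓘(ℝ, ℝ)) (m := ∞) (n := ∞)
    (fun (q : ℝ × B) (s : ℝ) => Φ (s, q.2)) Prod.fst h0 contMDiffAt_fst (by simp)
  have h2 : ContMDiffAt (𝓘(ℝ, ℝ).prod I) 𝓘(ℝ, ℝ →L[ℝ] ℝ) ∞
      (fun q : ℝ × B => (fderiv ℝ (fun s => Φ (s, q.2)) q.1 : ℝ →L[ℝ] ℝ)) p := by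
    refine h1.congr_of_eventuallyEq (Filter.Eventually.of_forall fun q => ?_)
    have h3 := congrFun (inTangentCoordinates_model_space (I := 𝓘(ℝ, ℝ)) (I' := 𝓘(ℝ, ℝ))
      (fun q : ℝ × B => q.1) (fun q => Φ (q.1, q.2))
      (fun q => (mfderiv 𝓘(ℝ, ℝ) 𝓘(ℝ, ℝ) (fun s : ℝ => Φ (s, q.2)) q.1 : ℝ →L[ℝ] ℝ)) p) q
    refine Eq.trans ?_ h3.symm
    rw [mfderiv_eq_fderiv]
  exact (h2.continuousAt.clm_apply (continuousAt_const (y := (1 : ℝ)))).congr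
    (Filter.Eventually.of_forall fun q => rfl)

/-- The time derivative is jointly continuous, hence bounded on the compact set `closedBall t 1 ×
B`; the bound is integrable because `ν` is finite. -/
lemma hasDerivAt_integral_of_contMDiff [IsManifold I ∞ B] [CompactSpace B] [MeasurableSpace B]
    [BorelSpace B] (ν : Measure B) [IsFiniteMeasure ν]
    (hΦ : ContMDiff (𝓘(ℝ, ℝ).prod I) 𝓘(ℝ, ℝ) ∞ Φ) (t : ℝ) :
    HasDerivAt (fun s => ∫ x, Φ (s, x) ∂ν) (∫ x, deriv (fun s => Φ (s, x)) t ∂ν) t := by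
  have hD := continuous_deriv_slice hΦ
  obtain ⟨C, hC⟩ := ((isCompact_closedBall t 1).prod (isCompact_univ (X := B))).exists_bound_of_continuousOn
    hD.continuousOn
  have hsl : ∀ s, Continuous fun x => Φ (s, x) := fun s =>
    hΦ.continuous.comp (by fun_prop)
  refine (hasDerivAt_integral_of_dominated_loc_of_deriv_le (bound := fun _ => C)
    (F := fun s x => Φ (s, x)) (F' := fun s x => deriv (fun s => Φ (s, x)) s)
    (Metric.closedBall_mem_nhds t one_pos) ?_ ?_ ?_ ?_ (integrable_const _) ?_).2
  · exact Filter.Eventually.of_forall fun s => (hsl s).aestronglyMeasurable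
  · exact (hsl t).integrable_of_hasCompactSupport (HasCompactSupport.of_compactSpace _)
  · exact (hD.comp (g := fun p : ℝ × B => deriv (fun s => Φ (s, p.2)) p.1)
      (f := fun x => (t, x)) (by fun_prop)).aestronglyMeasurable
  · exact Filter.Eventually.of_forall fun x s hs => hC (s, x) ⟨hs, mem_univ x⟩
  · exact Filter.Eventually.of_forall fun x s _ => hasDerivAt_slice hΦ s x

end ParametricIntegral

/-! ### Rate of change of the stored energy. -/

section EnergyRate

open Set Topology

variable {m : ℕ} {H : Type*} [TopologicalSpace H]
  {I : ModelWithCorners ℝ (EuclideanSpace ℝ (Fin (m + 1))) H}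
  {B : Type*} [TopologicalSpace B] [ChartedSpace H B] [IsManifold I ∞ B]
  {F : Type*} [NormedAddCommGroup F] [NormedSpace ℝ F] {W : B → Type*}
  [TopologicalSpace (TotalSpace F W)] [∀ x, AddCommGroup (W x)] [∀ x, Module ℝ (W x)]
  [∀ x, TopologicalSpace (W x)] [∀ x, IsTopologicalAddGroup (W x)] [∀ x, ContinuousSMul ℝ (W x)]
  [FiberBundle F W] [VectorBundle ℝ F W] [ContMDiffVectorBundle ∞ F W I]
  {U : Set (TotalSpace F W)}

/-- The chain rule in the model fibre `F`: the trivialization at `x` identifies `W x` with `F`,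
where `ψ` becomes an ordinary smooth function near the point. -/
lemma hasDerivAt_fibre {ψ : TotalSpace F W → ℝ} (hU : IsOpen U)
    (hψ : ContMDiffOn (I.prod 𝓘(ℝ, F)) 𝓘(ℝ, ℝ) ∞ ψ U) {x : B} {γ : ℝ → W x} {v : W x} {t : ℝ}
    (hmem : TotalSpace.mk' F x (γ t) ∈ U) (hγ : HasDerivAt γ v t) :
    HasDerivAt (fun s => ψ (TotalSpace.mk' F x (γ s))) (fibreDeriv ψ x (γ t) v) t := by
  let e := trivializationAt F W x
  have hx : x ∈ e.baseSet := mem_baseSet_trivializationAt F W x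
  let L := e.continuousLinearEquivAt ℝ x hx
  have hG : ContMDiffAt 𝓘(ℝ, F) 𝓘(ℝ, ℝ) ∞
      (fun z : F => ψ (TotalSpace.mk' F x (e.symm x z))) (L (γ t)) := by
    have h1 : ContMDiff 𝓘(ℝ, F) (I.prod 𝓘(ℝ, F)) ∞
        (fun z : F => TotalSpace.mk' F x (e.symm x z)) := by
      have h2 : ContMDiffOn 𝓘(ℝ, F) (I.prod 𝓘(ℝ, F)) ∞
          (fun z : F => e.toOpenPartialHomeomorph.symm (x, z)) univ :=
        (e.contMDiffOn_symm (IB := I) (n := ∞)).comp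
          (contMDiffOn_const.prodMk contMDiffOn_id) fun z _ => e.mem_target.2 hx
      exact (contMDiffOn_univ.1 h2).congr fun z => e.mk_symm hx z
    refine ContMDiffAt.comp _ ?_ h1.contMDiffAt
    have h3 : e.symm x (L (γ t)) = γ t := L.symm_apply_apply (γ t)
    rw [h3]
    exact hψ.contMDiffAt (hU.mem_nhds hmem)
  have hd : DifferentiableAt ℝ (fun z : F => ψ (TotalSpace.mk' F x (e.symm x z))) (L (γ t)) :=
    hG.contDiffAt.differentiableAt (by simp)
  have h4 := hd.hasFDerivAt.comp_hasDerivAt t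
    (hasDerivAt_clm_comp (L : W x →L[ℝ] F) hγ)
  have h5 : ((fun z : F => ψ (TotalSpace.mk' F x (e.symm x z))) ∘ fun s => (L : W x →L[ℝ] F) (γ s))
      = fun s => ψ (TotalSpace.mk' F x (γ s)) := by
    funext s
    exact congrArg (fun w => ψ (TotalSpace.mk' F x w)) (L.symm_apply_apply (γ s))
  rw [h5] at h4
  have h6 := fibreDeriv_eq ψ x (γ t) hx (L v)
  rw [show (trivializationAt F W x).symm x (L v) = v from L.symm_apply_apply v] at h6
  rw [h6]
  exact h4

variable [CompactSpace B] [T2Space B]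

/-- The stored energy changes at the rate `∫ Tf h ∧̇ ⋆_c ∂ψ/∂ζ` along a smooth motion with
velocity `h`. -/
lemma hasDerivAt_storedEnergy (μ : MassForm I B) {ψ : TotalSpace F W → ℝ} (hU : IsOpen U)
    (hψ : ContMDiffOn (I.prod 𝓘(ℝ, F)) 𝓘(ℝ, ℝ) ∞ ψ U) {f : Metric I B → DeformationSpace I U}
    {g : Metric I B} {Tf : SymTensor I B → Cₛ^∞⟮I; F, W⟯} (hTf : IsTangentMap f g Tf)
    {c : ℝ → Metric I B} {h : SymTensor I B} (hc : SmoothMetricCurve c) (hc0 : c 0 = g)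
    (hh : HasVelocity c h) :
    HasDerivAt (fun t => storedEnergy μ ψ (f (c t)))
      (bodyIntegral μ fun x => sectionWedge (Tf h x) ((starPartial μ ψ hU hψ (f g)).toFun x))
      0 := by
  obtain ⟨hsm, hder⟩ := hTf c h hc hc0 hh
  borelize B
  obtain ⟨ν, hν, -, hint⟩ := exists_measure_bodyIntegral μ
  have hΦ : ContMDiff (𝓘(ℝ, ℝ).prod I) 𝓘(ℝ, ℝ) ∞
      (fun p : ℝ × B => ψ (TotalSpace.mk' F p.2 ((f (c p.1)).1 p.2))) :=
    hψ.comp_contMDiff hsm fun p => (f (c p.1)).2 p.2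
  have hderiv : ∀ x, deriv (fun s => ψ (TotalSpace.mk' F x ((f (c s)).1 x))) 0 =
      fibreDeriv ψ x ((f g).1 x) (Tf h x) := fun x => by
    have := (hasDerivAt_fibre hU hψ ((f (c 0)).2 x) (hder x)).deriv
    rwa [hc0] at this
  -- The integrand is the time derivative at `0` of a jointly smooth function, so its continuity
  -- needs no separate study of `fibreDeriv` and `Tf h`.
  have hcont : Continuous fun x => fibreDeriv ψ x ((f g).1 x) (Tf h x) := by
    simp only [← hderiv]
    exact (continuous_deriv_slice hΦ).comp (f := fun x => ((0 : ℝ), x)) (by fun_prop)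
  have h1 := hasDerivAt_integral_of_contMDiff ν hΦ 0
  simp only [hderiv] at h1
  rw [← hint _ hcont] at h1
  have h2 : ∀ t, storedEnergy μ ψ (f (c t)) =
      ∫ x, ψ (TotalSpace.mk' F x ((f (c t)).1 x)) ∂ν := fun t =>
    hint _ (hΦ.continuous.comp (f := fun x => (t, x)) (by fun_prop))
  simp only [h2]
  convert h1 using 2
  funext x
  ext v
  exact mul_comm _ _

end EnergyRate

/-! ### Smoothness of rank-one homomorphisms and of affine families of sections. -/

section Sections

open Set Topology

variable {E : Type*} [NormedAddCommGroup E] [NormedSpace ℝ E] {H : Type*} [TopologicalSpace H]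
  {I : ModelWithCorners ℝ E H} {B : Type*} [TopologicalSpace B] [ChartedSpace H B]
  {F₁ F₂ : Type*} [NormedAddCommGroup F₁] [NormedSpace ℝ F₁] [NormedAddCommGroup F₂]
  [NormedSpace ℝ F₂] {E₁ E₂ : B → Type*} [TopologicalSpace (TotalSpace F₁ E₁)]
  [∀ x, AddCommGroup (E₁ x)] [∀ x, Module ℝ (E₁ x)] [∀ x, TopologicalSpace (E₁ x)]
  [FiberBundle F₁ E₁] [VectorBundle ℝ F₁ E₁]
  [TopologicalSpace (TotalSpace F₂ E₂)]
  [∀ x, AddCommGroup (E₂ x)] [∀ x, Module ℝ (E₂ x)] [∀ x, TopologicalSpace (E₂ x)]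
  [FiberBundle F₂ E₂] [VectorBundle ℝ F₂ E₂]
  [∀ x, IsTopologicalAddGroup (E₂ x)] [∀ x, ContinuousSMul ℝ (E₂ x)]

lemma contMDiffWithinAt_smulRight {s : Set B} {x : B} {φ : ∀ x, E₁ x →L[ℝ] ℝ} {v : ∀ x, E₂ x}
    (hφ : ContMDiffWithinAt I (I.prod 𝓘(ℝ, F₁ →L[ℝ] ℝ)) ∞
      (fun x => TotalSpace.mk' (F₁ →L[ℝ] ℝ) (E := fun x => E₁ x →L[ℝ] Bundle.Trivial B ℝ x)
        x (φ x)) s x)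
    (hv : ContMDiffWithinAt I (I.prod 𝓘(ℝ, F₂)) ∞ (fun x => TotalSpace.mk' F₂ x (v x)) s x) :
    ContMDiffWithinAt I (I.prod 𝓘(ℝ, F₁ →L[ℝ] F₂)) ∞
      (fun x => TotalSpace.mk' (F₁ →L[ℝ] F₂) (E := fun x => E₁ x →L[ℝ] E₂ x)
        x ((φ x).smulRight (v x))) s x := by
  rw [contMDiffWithinAt_hom_bundle] at hφ ⊢
  rw [contMDiffWithinAt_totalSpace] at hv
  refine ⟨contMDiffWithinAt_id, ?_⟩
  have h0 : ContDiff ℝ ∞ fun p : (F₁ →L[ℝ] ℝ) × F₂ => p.1.smulRight p.2 :=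
    contDiff_fst.smulRight contDiff_snd
  have h1 := h0.contMDiff.contMDiffAt.comp_contMDiffWithinAt x (hφ.2.prodMk_space hv.2)
  have hmem : ∀ᶠ y in 𝓝 x, y ∈ (trivializationAt F₂ E₂ x).baseSet :=
    (trivializationAt F₂ E₂ x).open_baseSet.mem_nhds (mem_baseSet_trivializationAt F₂ E₂ x)
  -- The coordinate formula is claimed only over the base set of the second trivialization, where
  -- the fibre coordinate is the linear map `continuousLinearMapAt`; this is a neighbourhood of `x`.
  have key : ∀ y ∈ (trivializationAt F₂ E₂ x).baseSet,
      ContinuousLinearMap.inCoordinates F₁ E₁ F₂ E₂ x y x y ((φ y).smulRight (v y)) =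
      (ContinuousLinearMap.inCoordinates F₁ E₁ ℝ (Bundle.Trivial B ℝ) x y x y (φ y)).smulRight
        (trivializationAt F₂ E₂ x ⟨y, v y⟩).2 := fun y hy => by
    ext z
    simp only [ContinuousLinearMap.inCoordinates, ContinuousLinearMap.comp_apply,
      ContinuousLinearMap.smulRight_apply, map_smul]
    congr 1
    · simp
    · exact Trivialization.continuousLinearMapAt_apply_of_mem ℝ _ hy _
  exact h1.congr_of_eventuallyEq (hmem.filter_mono nhdsWithin_le_nhds |>.mono key)
    (key x (mem_baseSet_trivializationAt F₂ E₂ x))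

lemma contMDiff_add_smul_section [ContMDiffVectorBundle ∞ F₁ E₁ I] {s₁ s₂ : ∀ x, E₁ x} {r : ℝ → ℝ}
    (h₁ : ContMDiff I (I.prod 𝓘(ℝ, F₁)) ∞ fun x => TotalSpace.mk' F₁ x (s₁ x))
    (h₂ : ContMDiff I (I.prod 𝓘(ℝ, F₁)) ∞ fun x => TotalSpace.mk' F₁ x (s₂ x))
    (hr : ContDiff ℝ ∞ r) :
    ContMDiff (𝓘(ℝ, ℝ).prod I) (I.prod 𝓘(ℝ, F₁)) ∞
      fun p : ℝ × B => TotalSpace.mk' F₁ p.2 (s₁ p.2 + r p.1 • s₂ p.2) := by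
  intro p
  rw [contMDiffAt_totalSpace]
  refine ⟨contMDiffAt_snd, ?_⟩
  have h₁' := (contMDiffAt_totalSpace.1 ((h₁.comp (contMDiff_snd (I := 𝓘(ℝ, ℝ)) (M := ℝ))) p)).2
  have h₂' := (contMDiffAt_totalSpace.1 ((h₂.comp (contMDiff_snd (I := 𝓘(ℝ, ℝ)) (M := ℝ))) p)).2
  have hr' : ContMDiffAt (𝓘(ℝ, ℝ).prod I) 𝓘(ℝ, ℝ) ∞ (fun p : ℝ × B => r p.1) p :=
    (hr.contMDiff.comp contMDiff_fst) p
  refine (h₁'.add (hr'.smul h₂')).congr_of_eventuallyEq ?_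
  have hmem : Prod.snd ⁻¹' (trivializationAt F₁ E₁ p.2).baseSet ∈ 𝓝 p :=
    continuousAt_snd.preimage_mem_nhds ((trivializationAt F₁ E₁ p.2).open_baseSet.mem_nhds
      (mem_baseSet_trivializationAt F₁ E₁ p.2))
  filter_upwards [hmem] with q hq
  have hlin := (trivializationAt F₁ E₁ p.2).linear ℝ hq
  exact (hlin.map_add _ _).trans (congrArg _ (hlin.map_smul _ _))

end Sections

/-! ### Rank-one strain rates and the motions that realize them. -/

section TestFields

open Set Topology

variable {m : ℕ} {H : Type*} [TopologicalSpace H]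
  {I : ModelWithCorners ℝ (EuclideanSpace ℝ (Fin (m + 1))) H}
  {B : Type*} [TopologicalSpace B] [ChartedSpace H B] [IsManifold I ∞ B]

lemma Metric.inner_self_nonneg (g : Metric I B) (x : B) (v : TangentSpace I x) :
    0 ≤ g.inner x v v := by
  rcases eq_or_ne v 0 with rfl | hv
  · simp
  · exact (g.pos x v hv).le

lemma Metric.ext_inner {g g' : Metric I B} (h : g.inner = g'.inner) : g = g' := by
  cases g
  cases g'
  congr

lemma Metric.sq_le (g : Metric I B) (x : B) (u w : TangentSpace I x) :
    g.inner x u w ^ 2 ≤ g.inner x u u * g.inner x w w := by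
  exact LinearMap.BilinForm.apply_sq_le_of_symm (g.inner x).toBilinForm (g.inner_self_nonneg x)
    ⟨fun v w => g.symm x v w⟩ u w

lemma contMDiffOn_inner_frame (g : Metric I B) (x₀ : B) (a : EuclideanSpace ℝ (Fin (m + 1))) :
    ContMDiffOn I (I.prod 𝓘(ℝ, EuclideanSpace ℝ (Fin (m + 1)) →L[ℝ] ℝ)) ∞
      (fun x => TotalSpace.mk' (EuclideanSpace ℝ (Fin (m + 1)) →L[ℝ] ℝ)
        (E := fun x : B => TangentSpace I x →L[ℝ] Bundle.Trivial B ℝ x)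
        x (g.inner x (frame I x₀ x a))) (chartAt H x₀).source :=
  ContMDiffOn.clm_bundle_apply (F₂ := EuclideanSpace ℝ (Fin (m + 1)) →L[ℝ] ℝ)
    (E₂ := fun x : B => TangentSpace I x →L[ℝ] Bundle.Trivial B ℝ x)
    (b := fun x => x) (ϕ := fun x => g.inner x)
    g.contMDiff.contMDiffOn (frame_smooth x₀ a)

lemma contMDiffOn_inner_frame_frame (g : Metric I B) (x₀ : B)
    (a b : EuclideanSpace ℝ (Fin (m + 1))) :
    ContMDiffOn I 𝓘(ℝ, ℝ) ∞
      (fun x => g.inner x (frame I x₀ x a) (frame I x₀ x b)) (chartAt H x₀).source := by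
  intro x hx
  have h := (contMDiffOn_inner_frame g x₀ a x hx).clm_bundle_apply (frame_smooth x₀ b x hx)
  rw [contMDiffWithinAt_totalSpace] at h
  exact h.2

/-- The vector-valued `1`-form `χ g(a, ·) b`, where `a` and `b` have constant components in the
chart at `x₀` and the function `χ` is supported in that chart. -/
def rankOneField (g : Metric I B) (x₀ : B) (χ : C^∞⟮I, B; ℝ⟯)
    (hχ : tsupport χ ⊆ (chartAt H x₀).source) (a b : EuclideanSpace ℝ (Fin (m + 1))) :
    VectorOneForm I B where
  toFun x := χ x • (g.inner x (frame I x₀ x a)).smulRight (frame I x₀ x b)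
  contMDiff_toFun := χ.contMDiff.contMDiffOn.smul_section_of_tsupport (chartAt H x₀).open_source hχ
    fun x hx => contMDiffWithinAt_smulRight (contMDiffOn_inner_frame g x₀ a x hx)
      (frame_smooth x₀ b x hx)

/-- The symmetric `2`-tensor field `χ g(a, ·) g(a, ·)`. -/
def squareField (g : Metric I B) (x₀ : B) (χ : C^∞⟮I, B; ℝ⟯)
    (a : EuclideanSpace ℝ (Fin (m + 1))) (x : B) : TangentSpace I x →L[ℝ] TangentSpace I x →L[ℝ] ℝ :=
  χ x • (g.inner x (frame I x₀ x a)).smulRight (g.inner x (frame I x₀ x a))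

lemma squareField_apply (g : Metric I B) (x₀ : B) (χ : C^∞⟮I, B; ℝ⟯)
    (a : EuclideanSpace ℝ (Fin (m + 1))) (x : B) (u w : TangentSpace I x) :
    squareField g x₀ χ a x u w =
      χ x * (g.inner x (frame I x₀ x a) u * g.inner x (frame I x₀ x a) w) := rfl

lemma contMDiff_squareField (g : Metric I B) (x₀ : B) (χ : C^∞⟮I, B; ℝ⟯)
    (hχ : tsupport χ ⊆ (chartAt H x₀).source) (a : EuclideanSpace ℝ (Fin (m + 1))) :
    ContMDiff I (I.prod 𝓘(ℝ, EuclideanSpace ℝ (Fin (m + 1)) →L[ℝ]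
      EuclideanSpace ℝ (Fin (m + 1)) →L[ℝ] ℝ)) ∞
      (fun x => TotalSpace.mk' (EuclideanSpace ℝ (Fin (m + 1)) →L[ℝ]
        EuclideanSpace ℝ (Fin (m + 1)) →L[ℝ] ℝ)
        (E := fun x : B => TangentSpace I x →L[ℝ] TangentSpace I x →L[ℝ] Bundle.Trivial B ℝ x)
        x (squareField g x₀ χ a x)) :=
  χ.contMDiff.contMDiffOn.smul_section_of_tsupport (chartAt H x₀).open_source hχ
    (F := EuclideanSpace ℝ (Fin (m + 1)) →L[ℝ] EuclideanSpace ℝ (Fin (m + 1)) →L[ℝ] ℝ)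
    (V := fun x : B => TangentSpace I x →L[ℝ] TangentSpace I x →L[ℝ] Bundle.Trivial B ℝ x)
    fun x hx => contMDiffWithinAt_smulRight
      (E₂ := fun x : B => TangentSpace I x →L[ℝ] Bundle.Trivial B ℝ x)
      (contMDiffOn_inner_frame g x₀ a x hx) (contMDiffOn_inner_frame g x₀ a x hx)

/-- The metric `g + 2 r χ g(a, ·) g(a, ·)` for small `r`. -/
def Metric.perturb (g : Metric I B) (x₀ : B) (χ : C^∞⟮I, B; ℝ⟯)
    (hχ : tsupport χ ⊆ (chartAt H x₀).source) (a : EuclideanSpace ℝ (Fin (m + 1))) (r : ℝ)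
    (hr : ∀ x, |2 * r * χ x| * g.inner x (frame I x₀ x a) (frame I x₀ x a) ≤ 2⁻¹) :
    Metric I B :=
  -- By Cauchy–Schwarz, `hr` bounds the perturbation by half of `g`; this lower bound gives both
  -- positivity and bounded unit balls.
  have hhalf : ∀ (x : B) (v : TangentSpace I x), 2⁻¹ * g.inner x v v ≤
      (g.inner x + (2 * r) • squareField g x₀ χ a x) v v := fun x v => by
    change _ ≤ g.inner x v v + (2 * r) * squareField g x₀ χ a x v v
    rw [squareField_apply]
    have h1 := g.sq_le x (frame I x₀ x a) v
    have h2 := g.inner_self_nonneg x v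
    have h3 : |2 * r * χ x| * g.inner x (frame I x₀ x a) v ^ 2 ≤ 2⁻¹ * g.inner x v v :=
      calc _ ≤ |2 * r * χ x| * (g.inner x (frame I x₀ x a) (frame I x₀ x a) * g.inner x v v) := by
            gcongr
        _ = |2 * r * χ x| * g.inner x (frame I x₀ x a) (frame I x₀ x a) * g.inner x v v := by ring
        _ ≤ _ := by gcongr; exact hr x
    have h4 : -|2 * r * χ x| * g.inner x (frame I x₀ x a) v ^ 2 ≤
        2 * r * χ x * g.inner x (frame I x₀ x a) v ^ 2 := by
      gcongr
      exact neg_abs_le _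
    nlinarith
  { inner := fun x => g.inner x + (2 * r) • squareField g x₀ χ a x
    symm := fun x v w => by
      change g.inner x v w + (2 * r) * squareField g x₀ χ a x v w =
        g.inner x w v + (2 * r) * squareField g x₀ χ a x w v
      rw [squareField_apply, squareField_apply, g.symm x v w, mul_comm (g.inner x _ v)]
    pos := fun x v hv => (mul_pos (by norm_num) (g.pos x v hv)).trans_le (hhalf x v)
    isVonNBounded := fun x => by
      -- The unit ball of the new metric lies in `√2` times that of `g`.
      refine ((g.isVonNBounded x).image
        (Real.sqrt 2 • ContinuousLinearMap.id ℝ (TangentSpace I x))).subset fun v hv => ?_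
      refine ⟨(Real.sqrt 2)⁻¹ • v, ?_, ?_⟩
      · have h1 := (hhalf x v).trans_lt hv
        have h2 : (Real.sqrt 2)⁻¹ * ((Real.sqrt 2)⁻¹ * g.inner x v v) = 2⁻¹ * g.inner x v v := by
          rw [← mul_assoc, ← mul_inv, Real.mul_self_sqrt (by norm_num)]
        simpa [h2] using! h1
      · change Real.sqrt 2 • ((Real.sqrt 2)⁻¹ • v) = v
        rw [smul_smul, mul_inv_cancel₀ (by positivity), one_smul]
    contMDiff := by
      have h := (contMDiff_add_smul_section (r := fun _ => 2 * r)
        (E₁ := fun x : B => TangentSpace I x →L[ℝ] TangentSpace I x →L[ℝ] Bundle.Trivial B ℝ x)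
        g.contMDiff (contMDiff_squareField g x₀ χ hχ a) contDiff_const)
      exact h.comp (f := fun x : B => ((0 : ℝ), x)) (contMDiff_const.prodMk contMDiff_id) }

lemma smoothMetricCurve_perturb (g : Metric I B) (x₀ : B) (χ : C^∞⟮I, B; ℝ⟯)
    (hχ : tsupport χ ⊆ (chartAt H x₀).source) (a : EuclideanSpace ℝ (Fin (m + 1))) {r : ℝ → ℝ}
    (hr : ContDiff ℝ ∞ r)
    (h : ∀ t x, |2 * r t * χ x| * g.inner x (frame I x₀ x a) (frame I x₀ x a) ≤ 2⁻¹) :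
    SmoothMetricCurve fun t => g.perturb x₀ χ hχ a (r t) (h t) := by
  have h := (contMDiff_add_smul_section (r := fun t => 2 * r t)
    (E₁ := fun x : B => TangentSpace I x →L[ℝ] TangentSpace I x →L[ℝ] Bundle.Trivial B ℝ x)
    g.contMDiff (contMDiff_squareField g x₀ χ hχ a) (contDiff_const.mul hr))
  exact h

/-- Every strain rate `χ g(a, ·) a` is realized by a smooth curve of metrics through `g`. -/
lemma exists_curve [CompactSpace B] (g : Metric I B) (x₀ : B) (χ : C^∞⟮I, B; ℝ⟯)
    (hχ : tsupport χ ⊆ (chartAt H x₀).source) (a : EuclideanSpace ℝ (Fin (m + 1))) :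
    ∃ c : ℝ → Metric I B, SmoothMetricCurve c ∧ c 0 = g ∧
      ∀ (x : B) (u w : TangentSpace I x), HasDerivAt (fun t => (c t).inner x u w)
        (2 * g.inner x (rankOneField g x₀ χ hχ a a x u) w) 0 := by
  have hcont : Continuous fun x => χ x * g.inner x (frame I x₀ x a) (frame I x₀ x a) :=
    continuous_of_continuousOn_tsupport (chartAt H x₀).open_source
      (χ.contMDiff.continuous.continuousOn.mul
        (contMDiffOn_inner_frame_frame g x₀ a a).continuousOn)
      ((closure_mono (Function.support_mul_subset_left _ _)).trans hχ)
  obtain ⟨C, hC⟩ := isCompact_univ.exists_bound_of_continuousOn hcont.continuousOn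
  -- Chosen so that `2 * δ * (|C| + 1) = 2⁻¹`; the shape `|C| + 1` keeps the denominator positive
  -- whatever `C` is.
  set δ : ℝ := (4 * (|C| + 1))⁻¹ with hδ
  have hδ0 : 0 < δ := by positivity
  -- The curve must consist of metrics for all real `t`: this `r` is smooth, stays within `δ`, and
  -- has `r 0 = 0` and derivative `1` at `0`.
  let r : ℝ → ℝ := fun t => δ * Real.sin (δ⁻¹ * t)
  have hrδ : ∀ t, |r t| ≤ δ := fun t => by
    rw [abs_mul, abs_of_pos hδ0]
    exact mul_le_of_le_one_right hδ0.le (Real.abs_sin_le_one _)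
  have hbound : ∀ t x, |2 * r t * χ x| * g.inner x (frame I x₀ x a) (frame I x₀ x a) ≤ 2⁻¹ := by
    intro t x
    have h1 : |χ x * g.inner x (frame I x₀ x a) (frame I x₀ x a)| ≤ |C| + 1 :=
      (hC x (mem_univ x)).trans ((le_abs_self C).trans (by linarith))
    calc |2 * r t * χ x| * g.inner x (frame I x₀ x a) (frame I x₀ x a)
        = 2 * |r t| * |χ x * g.inner x (frame I x₀ x a) (frame I x₀ x a)| := by
          rw [abs_mul, abs_mul, abs_mul (χ x), abs_of_nonneg (g.inner_self_nonneg x _), abs_two]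
          ring
      _ ≤ 2 * δ * (|C| + 1) := by
          have := hrδ t
          gcongr
      _ = 2⁻¹ := by
          rw [hδ]; field_simp; norm_num
  have hr : ContDiff ℝ ∞ r := by fun_prop
  refine ⟨fun t => g.perturb x₀ χ hχ a (r t) (hbound t), ?_, ?_, fun x u w => ?_⟩
  · exact smoothMetricCurve_perturb g x₀ χ hχ a hr hbound
  · have h0 : (g.perturb x₀ χ hχ a (r 0) (hbound 0)).inner = g.inner := by
      funext x
      refine ContinuousLinearMap.ext fun u => ContinuousLinearMap.ext fun w => ?_
      change g.inner x u w + (2 * (δ * Real.sin (δ⁻¹ * 0))) * squareField g x₀ χ a x u w = _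
      rw [mul_zero, Real.sin_zero, mul_zero, mul_zero, zero_mul, add_zero]
    exact Metric.ext_inner h0
  · change HasDerivAt (fun t => g.inner x u w +
      2 * (δ * Real.sin (δ⁻¹ * t)) * squareField g x₀ χ a x u w)
      (2 * g.inner x (χ x • (g.inner x (frame I x₀ x a) u • frame I x₀ x a)) w) 0
    have h1 : HasDerivAt (fun t => δ * Real.sin (δ⁻¹ * t)) 1 0 := by
      have := (((hasDerivAt_id (0 : ℝ)).const_mul δ⁻¹).sin).const_mul δ
      simpa [hδ0.ne'] using this
    have h2 := ((h1.const_mul 2).mul_const (squareField g x₀ χ a x u w)).const_add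
      (g.inner x u w)
    have h3 : 2 * g.inner x (χ x • (g.inner x (frame I x₀ x a) u • frame I x₀ x a)) w =
        2 * 1 * squareField g x₀ χ a x u w := by
      rw [squareField_apply, map_smul, map_smul, mul_one]
      rfl
    rw [h3]
    exact h2

end TestFields

/-! ### Localization, symmetry of the dual, and the energy rate in terms of strain. -/

section DoyleEricksen

open Set Topology

variable {m : ℕ} {H : Type*} [TopologicalSpace H]
  {I : ModelWithCorners ℝ (EuclideanSpace ℝ (Fin (m + 1))) H}
  {B : Type*} [TopologicalSpace B] [ChartedSpace H B] [IsManifold I ∞ B]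

lemma wedgeDot_hodge_rankOne (g : Metric I B) (μ : MassForm I B) (x : B)
    (τ : TangentSpace I x →ₗ[ℝ] TangentSpace I x) (a b : TangentSpace I x) :
    wedgeDot (((g.inner x).toBilinForm a).smulRight b) (hodge g μ x τ) =
      g.inner x (τ a) b • μ.toFun x :=
  wedgeDot_starC_rankOne _ (g.nondegenerate x) (fun u w => g.symm x u w) _ (μ.ne_zero x) _ τ a b

lemma wedgeDot_rankOneField (g : Metric I B) (μ : MassForm I B) (x₀ : B) (χ : C^∞⟮I, B; ℝ⟯)
    (hχ : tsupport χ ⊆ (chartAt H x₀).source) (a b : EuclideanSpace ℝ (Fin (m + 1))) (x : B)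
    (τ : TangentSpace I x →ₗ[ℝ] TangentSpace I x) :
    wedgeDot (rankOneField g x₀ χ hχ a b x).toLinearMap (hodge g μ x τ) =
      (χ x * g.inner x (τ (frame I x₀ x a)) (frame I x₀ x b)) • μ.toFun x := by
  have h : (rankOneField g x₀ χ hχ a b x).toLinearMap =
      χ x • ((g.inner x).toBilinForm (frame I x₀ x a)).smulRight (frame I x₀ x b) := rfl
  rw [h, wedgeDot_smul_left, wedgeDot_hodge_rankOne, smul_smul]

/-- No formula for the inverse star is needed. The rank-one identity, evaluated on the frame,
expresses the function times the component of `μ` through components of `g` and `T`; one divides by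
that component, which has no zero in the chart. -/
lemma continuousOn_hodge_symm (g : Metric I B) (μ : MassForm I B)
    (T : CoForm I m (EuclideanSpace ℝ (Fin (m + 1))) (fun x : B => TangentSpace I x)) (x₀ : B)
    (a b : EuclideanSpace ℝ (Fin (m + 1))) :
    ContinuousOn (fun x => g.inner x ((hodge g μ x).symm (T.toFun x) (frame I x₀ x a))
      (frame I x₀ x b)) (chartAt H x₀).source := by
  let e : Fin (m + 1) → EuclideanSpace ℝ (Fin (m + 1)) := fun j => EuclideanSpace.single j 1
  have h1 : ∀ x, g.inner x ((hodge g μ x).symm (T.toFun x) (frame I x₀ x a)) (frame I x₀ x b) *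
      μ.comp x₀ x = ∑ i : Fin (m + 1), (-1) ^ (i : ℕ) * (g.inner x (frame I x₀ x a)
        (frame I x₀ x (e i)) * T.toFun x (fun j => frame I x₀ x (i.removeNth e j))
          (frame I x₀ x b)) := fun x => by
    have h2 := congrArg (fun η => η fun j => frame I x₀ x (e j))
      (wedgeDot_hodge_rankOne g μ x ((hodge g μ x).symm (T.toFun x)) (frame I x₀ x a)
        (frame I x₀ x b))
    simp only [LinearEquiv.apply_symm_apply] at h2
    refine h2.symm.trans ?_
    rw [wedgeDot_apply]
    refine Finset.sum_congr rfl fun i _ => ?_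
    rw [LinearMap.smulRight_apply, map_smul]
    rfl
  have h3 : ContinuousOn (fun x => (∑ i : Fin (m + 1), (-1) ^ (i : ℕ) *
      (g.inner x (frame I x₀ x a) (frame I x₀ x (e i)) *
        T.toFun x (fun j => frame I x₀ x (i.removeNth e j)) (frame I x₀ x b))) / μ.comp x₀ x)
      (chartAt H x₀).source := by
    refine (continuousOn_finsetSum _ fun i _ => continuousOn_const.mul
      ((contMDiffOn_inner_frame_frame g x₀ a (e i)).continuousOn.mul ?_)).div
      (μ.continuousOn_comp x₀) fun x hx => μ.comp_ne_zero hx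
    exact (T.smooth x₀ (i.removeNth e) b).continuousOn.mono fun x hx => ⟨hx, hx⟩
  refine h3.congr fun x hx => ?_
  beta_reduce
  rw [← h1, mul_div_cancel_right₀ _ (μ.comp_ne_zero hx)]

lemma exists_frame_eq (x₀ : B) (u : TangentSpace I x₀) : ∃ a, frame I x₀ x₀ a = u :=
  ⟨_, ((trivializationAt (EuclideanSpace ℝ (Fin (m + 1))) (TangentSpace I : B → Type _)
    x₀).continuousLinearEquivAt ℝ x₀ (mem_chart_source H x₀)).symm_apply_apply u⟩

lemma lowerSym_apply (g : Metric I B) (α : VectorOneForm I B) (x : B) (u w : TangentSpace I x) :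
    (lowerSym g α).toFun x u w = 2⁻¹ * (g.inner x (α x u) w + g.inner x (α x w) u) := rfl

lemma lowerSym_rankOneField_sub (g : Metric I B) (x₀ : B) (χ : C^∞⟮I, B; ℝ⟯)
    (hχ : tsupport χ ⊆ (chartAt H x₀).source) (a b : EuclideanSpace ℝ (Fin (m + 1))) (x : B)
    (u w : TangentSpace I x) :
    (lowerSym g (rankOneField g x₀ χ hχ a b +
      (-1 : ℝ) • rankOneField g x₀ χ hχ b a)).toFun x u w = 0 := by
  have h1 : ∀ v v' : TangentSpace I x, g.inner x ((rankOneField g x₀ χ hχ a b +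
      (-1 : ℝ) • rankOneField g x₀ χ hχ b a) x v) v' =
      χ x * (g.inner x (frame I x₀ x a) v * g.inner x (frame I x₀ x b) v') -
        χ x * (g.inner x (frame I x₀ x b) v * g.inner x (frame I x₀ x a) v') := fun v v' => by
    change g.inner x (χ x • (g.inner x (frame I x₀ x a) v • frame I x₀ x b) +
      (-1 : ℝ) • (χ x • (g.inner x (frame I x₀ x b) v • frame I x₀ x a))) v' = _
    simp only [map_add, map_smul, add_apply, smul_apply,
      smul_eq_mul]
    ring
  rw [lowerSym_apply, h1, h1]
  ring

/-- Metrics are symmetric at every time, so uniqueness of derivatives forces `ε` to be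
`g`-symmetric; symmetrizing `g · 2ε` then changes nothing. -/
lemma hasVelocity_lowerSym {c : ℝ → Metric I B} {g : Metric I B} {ε : VectorOneForm I B}
    (hε : ∀ (x : B) (u w : TangentSpace I x),
      HasDerivAt (fun t => (c t).inner x u w) (2 * g.inner x (ε x u) w) 0) :
    HasVelocity c (lowerSym g ((2 : ℝ) • ε)) := by
  intro x u w
  have h1 : 2 * g.inner x (ε x u) w = 2 * g.inner x (ε x w) u := by
    have h2 := hε x w u
    simp only [fun t => (c t).symm x w u] at h2
    exact (hε x u w).unique h2
  have h3 : (lowerSym g ((2 : ℝ) • ε)).toFun x u w = 2 * g.inner x (ε x u) w := by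
    have h4 : ∀ v v' : TangentSpace I x,
        g.inner x (((2 : ℝ) • ε) x v) v' = 2 * g.inner x (ε x v) v' := fun v v' => by
      change g.inner x ((2 : ℝ) • ε x v) v' = _
      rw [map_smul]
      rfl
    rw [lowerSym_apply, h4, h4]
    linarith
  rw [h3]
  exact hε x u w

variable [CompactSpace B] [T2Space B]

/-- The fundamental lemma of the calculus of variations. Were the values different, a bump function
at `x₀` would give a positive integral where the hypothesis gives zero. -/
lemma eq_of_bodyIntegral_eq (μ : MassForm I B) {x₀ : B} {p q : B → ℝ}
    (hp : ContinuousOn p (chartAt H x₀).source) (hq : ContinuousOn q (chartAt H x₀).source)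
    (h : ∀ χ : C^∞⟮I, B; ℝ⟯, tsupport χ ⊆ (chartAt H x₀).source →
      bodyIntegral μ (fun x => (χ x * p x) • μ.toFun x) =
        bodyIntegral μ (fun x => (χ x * q x) • μ.toFun x)) : p x₀ = q x₀ := by
  by_contra hne
  borelize B
  obtain ⟨ν, _, _, hint⟩ := exists_measure_bodyIntegral μ
  -- The constant factor makes the difference positive near `x₀`, whichever of the two values is
  -- larger.
  set d : B → ℝ := fun x => (p x - q x) * (p x₀ - q x₀) with hd
  have hdc : ContinuousOn d (chartAt H x₀).source := (hp.sub hq).mul continuousOn_const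
  have hd0 : 0 < d x₀ := mul_self_pos.2 (sub_ne_zero.2 hne)
  have hV : (chartAt H x₀).source ∩ d ⁻¹' Ioi 0 ∈ 𝓝 x₀ :=
    (hdc.isOpen_inter_preimage (chartAt H x₀).open_source isOpen_Ioi).mem_nhds
      ⟨mem_chart_source H x₀, hd0⟩
  obtain ⟨χ, -, hχV⟩ := (SmoothBumpFunction.nhds_basis_tsupport (I := I) x₀).mem_iff.1 hV
  let χ' : C^∞⟮I, B; ℝ⟯ := ⟨χ, χ.contMDiff⟩
  have hχs : tsupport χ' ⊆ (chartAt H x₀).source := hχV.trans inter_subset_left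
  have hcont : ∀ {r : B → ℝ}, ContinuousOn r (chartAt H x₀).source →
      Continuous fun x => χ x * r x := fun hr =>
    continuous_of_continuousOn_tsupport (chartAt H x₀).open_source
      (χ.contMDiff.continuous.continuousOn.mul hr)
      ((closure_mono (Function.support_mul_subset_left _ _)).trans hχs)
  have hi : ∀ {φ : B → ℝ}, Continuous φ → Integrable φ ν := fun hφ =>
    hφ.integrable_of_hasCompactSupport (HasCompactSupport.of_compactSpace _)
  have h1 : ∫ x, χ x * p x ∂ν = ∫ x, χ x * q x ∂ν := by
    rw [← hint _ (hcont hp), ← hint _ (hcont hq)]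
    exact h χ' hχs
  have h2 : ∫ x, χ x * d x ∂ν = 0 := by
    have h3 : ∀ x, χ x * d x = (χ x * p x - χ x * q x) * (p x₀ - q x₀) := fun x => by
      rw [hd]; ring
    simp only [h3]
    rw [integral_mul_const, integral_sub (hi (hcont hp)) (hi (hcont hq)), h1, sub_self, zero_mul]
  refine ((hcont hdc).integral_pos_of_hasCompactSupport_nonneg_nonzero
    (μ := ν) (HasCompactSupport.of_compactSpace _) (fun x => ?_) (x := x₀) ?_).ne' h2
  · by_cases hx : x ∈ tsupport χ
    · exact mul_nonneg χ.nonneg (hχV hx).2.le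
    · simp [image_eq_zero_of_notMem_tsupport hx]
  · simpa using hd0.ne'

variable {F : Type*} [NormedAddCommGroup F] [NormedSpace ℝ F] {W : B → Type*}
  [TopologicalSpace (TotalSpace F W)] [∀ x, AddCommGroup (W x)] [∀ x, Module ℝ (W x)]
  [∀ x, TopologicalSpace (W x)] [∀ x, IsTopologicalAddGroup (W x)] [∀ x, ContinuousSMul ℝ (W x)]
  [FiberBundle F W] [VectorBundle ℝ F W] [ContMDiffVectorBundle ∞ F W I]
  {U : Set (TotalSpace F W)}

/-- Along a smooth motion with strain rate `ε`, the stored energy changes at the rate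
`∫ ε ∧̇ 2 f̂* (⋆_c ∂ψ/∂ζ)`. -/
lemma hasDerivAt_storedEnergy_strain {μ : MassForm I B} {ψ : TotalSpace F W → ℝ} (hU : IsOpen U)
    (hψ : ContMDiffOn (I.prod 𝓘(ℝ, F)) 𝓘(ℝ, ℝ) ∞ ψ U) {f : Metric I B → DeformationSpace I U}
    {g : Metric I B} {Tf : SymTensor I B → Cₛ^∞⟮I; F, W⟯} (hTf : IsTangentMap f g Tf)
    {fStar : CoForm I (m + 1) F W →
      CoForm I m (EuclideanSpace ℝ (Fin (m + 1))) (fun x : B => TangentSpace I x)}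
    (hfStar : IsDual μ g Tf fStar) {c : ℝ → Metric I B} {ε : VectorOneForm I B}
    (hc : SmoothMetricCurve c) (hc0 : c 0 = g)
    (hε : ∀ (x : B) (u w : TangentSpace I x),
      HasDerivAt (fun t => (c t).inner x u w) (2 * g.inner x (ε x u) w) 0) :
    HasDerivAt (fun t => storedEnergy μ ψ (f (c t)))
      (bodyIntegral μ fun x => wedgeDot (ε x).toLinearMap
        ((2 : ℝ) • (fStar (starPartial μ ψ hU hψ (f g))).toFun x)) 0 := by
  have h1 := hasDerivAt_storedEnergy μ hU hψ hTf hc hc0 (hasVelocity_lowerSym hε)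
  -- Duality is applied to `2 • ε` itself, and the factor is moved across the wedge product
  -- afterwards, so that `Tf` need not be homogeneous.
  have h2 := hfStar ((2 : ℝ) • ε) (starPartial μ ψ hU hψ (f g))
  have h3 : (fun x => wedgeDot (ε x).toLinearMap
      ((2 : ℝ) • (fStar (starPartial μ ψ hU hψ (f g))).toFun x)) =
      fun x => wedgeDot (((2 : ℝ) • ε) x).toLinearMap
        ((fStar (starPartial μ ψ hU hψ (f g))).toFun x) := by
    funext x
    rw [wedgeDot_smul_right, ← wedgeDot_smul_left]
    rfl
  rw [h3, ← h2]
  exact h1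

/-- The zero tensor is the velocity of the constant curve at `g`, along which the energy is
constant. Comparing derivatives of the real-valued energy avoids any claim about `Tf 0` itself. -/
lemma bodyIntegral_eq_zero_of_lowerSym_eq_zero {μ : MassForm I B} {ψ : TotalSpace F W → ℝ}
    (hU : IsOpen U) (hψ : ContMDiffOn (I.prod 𝓘(ℝ, F)) 𝓘(ℝ, ℝ) ∞ ψ U)
    {f : Metric I B → DeformationSpace I U}
    {g : Metric I B} {Tf : SymTensor I B → Cₛ^∞⟮I; F, W⟯} (hTf : IsTangentMap f g Tf)
    {fStar : CoForm I (m + 1) F W →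
      CoForm I m (EuclideanSpace ℝ (Fin (m + 1))) (fun x : B => TangentSpace I x)}
    (hfStar : IsDual μ g Tf fStar) {α : VectorOneForm I B}
    (hα : ∀ (x : B) (u w : TangentSpace I x), (lowerSym g α).toFun x u w = 0) :
    bodyIntegral μ (fun x => wedgeDot (α x).toLinearMap
      ((fStar (starPartial μ ψ hU hψ (f g))).toFun x)) = 0 := by
  have h1 := hasDerivAt_storedEnergy μ hU hψ hTf (c := fun _ => g) (h := lowerSym g α)
    (g.contMDiff.comp contMDiff_snd) rfl fun x u w => by
      rw [hα]
      exact hasDerivAt_const _ _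
  rw [← hfStar]
  exact h1.unique (hasDerivAt_const _ _)

end DoyleEricksen

end Elasticity

end

/-! ### The generalized Doyle–Ericksen formula. -/

theorem mainTheorem10 {m : ℕ} {H : Type*} [TopologicalSpace H]
    (I : ModelWithCorners ℝ (EuclideanSpace ℝ (Fin (m + 1))) H)
    {B : Type*} [TopologicalSpace B] [ChartedSpace H B] [IsManifold I ∞ B]
    [CompactSpace B] [T2Space B] (μ : Elasticity.MassForm I B)
    {F : Type*} [NormedAddCommGroup F] [NormedSpace ℝ F] [FiniteDimensional ℝ F]
    {W : B → Type*} [TopologicalSpace (TotalSpace F W)] [∀ x, AddCommGroup (W x)]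
    [∀ x, Module ℝ (W x)] [∀ x, TopologicalSpace (W x)] [∀ x, IsTopologicalAddGroup (W x)]
    [∀ x, ContinuousSMul ℝ (W x)] [FiberBundle F W] [VectorBundle ℝ F W]
    [ContMDiffVectorBundle ∞ F W I]
    (U : Set (TotalSpace F W)) (hU : IsOpen U) (ψ : TotalSpace F W → ℝ)
    (hψ : ContMDiffOn (I.prod 𝓘(ℝ, F)) 𝓘(ℝ, ℝ) ∞ ψ U)
    (f : Elasticity.Metric I B → Elasticity.DeformationSpace I U) (g : Elasticity.Metric I B)
    (Tf : Elasticity.SymTensor I B → Cₛ^∞⟮I; F, W⟯) (hTf : Elasticity.IsTangentMap f g Tf)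
    (fStar : Elasticity.CoForm I (m + 1) F W →
      Elasticity.CoForm I m (EuclideanSpace ℝ (Fin (m + 1))) (fun x : B => TangentSpace I x))
    (hfStar : Elasticity.IsDual μ g Tf fStar)
    (τ : Elasticity.VectorOneForm I B) (hτ : Elasticity.IsSym g τ) :
    Elasticity.EnergyBalance μ ψ f g τ ↔
      ∀ x : B, (τ x).toLinearMap = (2 : ℝ) • (Elasticity.hodge g μ x).symm
        ((fStar (Elasticity.starPartial μ ψ hU hψ (f g))).toFun x) := by
  open Elasticity in
  set T := fStar (starPartial μ ψ hU hψ (f g)) with hT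
  let σ : ∀ x : B, TangentSpace I x →ₗ[ℝ] TangentSpace I x := fun x =>
    (hodge g μ x).symm (T.toFun x)
  have hσ : ∀ x, hodge g μ x (σ x) = T.toFun x := fun x => LinearEquiv.apply_symm_apply _ _
  constructor
  · intro hbal x₀
    -- The balance is tested on the motion with strain rate `χ g(a, ·) a`, for arbitrary `χ`
    -- supported in the chart at `x₀`; this compares the quadratic forms of `τ` and `2 σ`.
    have hdiag : ∀ a, g.inner x₀ (τ x₀ (frame I x₀ x₀ a)) (frame I x₀ x₀ a) =
        2 * g.inner x₀ (σ x₀ (frame I x₀ x₀ a)) (frame I x₀ x₀ a) := fun a => by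
      refine eq_of_bodyIntegral_eq μ (x₀ := x₀)
        (p := fun x => g.inner x (τ x (frame I x₀ x a)) (frame I x₀ x a))
        (q := fun x => 2 * g.inner x (σ x (frame I x₀ x a)) (frame I x₀ x a))
        (lowerSym_aux g τ x₀ a a).continuousOn
        (continuousOn_const.mul (continuousOn_hodge_symm g μ T x₀ a a)) fun χ hχ => ?_
      obtain ⟨c, hc, hc0, hder⟩ := exists_curve g x₀ χ hχ a
      have h1 := (hbal c _ hc hc0 hder).unique
        (hasDerivAt_storedEnergy_strain hU hψ hTf hfStar hc hc0 hder)
      simp only [← hT, wedgeDot_smul_right, ← hσ, wedgeDot_rankOneField, smul_smul] at h1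
      refine h1.trans (congrArg _ (funext fun x => ?_))
      rw [mul_left_comm]
    -- The test field `χ (g(a, ·) b - g(b, ·) a)` is `g`-antisymmetric, so its pairing with `T`
    -- integrates to zero; the integrand is `χ` times the defect of symmetry of `σ`.
    have hsymm : ∀ a b, g.inner x₀ (σ x₀ (frame I x₀ x₀ a)) (frame I x₀ x₀ b) =
        g.inner x₀ (σ x₀ (frame I x₀ x₀ b)) (frame I x₀ x₀ a) := fun a b => by
      rw [← sub_eq_zero]
      refine eq_of_bodyIntegral_eq μ (x₀ := x₀)
        (p := fun x => g.inner x (σ x (frame I x₀ x a)) (frame I x₀ x b) -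
          g.inner x (σ x (frame I x₀ x b)) (frame I x₀ x a)) (q := fun _ => 0)
        ((continuousOn_hodge_symm g μ T x₀ a b).sub (continuousOn_hodge_symm g μ T x₀ b a))
        continuousOn_const fun χ hχ => ?_
      have h1 := bodyIntegral_eq_zero_of_lowerSym_eq_zero hU hψ hTf hfStar
        (α := rankOneField g x₀ χ hχ a b + (-1 : ℝ) • rankOneField g x₀ χ hχ b a)
        fun x u w => lowerSym_rankOneField_sub g x₀ χ hχ a b x u w
      rw [← hT] at h1
      have h2 : ∀ x, wedgeDot ((rankOneField g x₀ χ hχ a b +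
          (-1 : ℝ) • rankOneField g x₀ χ hχ b a) x).toLinearMap (T.toFun x) =
          (χ x * (g.inner x (σ x (frame I x₀ x a)) (frame I x₀ x b) -
            g.inner x (σ x (frame I x₀ x b)) (frame I x₀ x a))) • μ.toFun x := fun x => by
        change wedgeDot ((rankOneField g x₀ χ hχ a b x).toLinearMap +
          (-1 : ℝ) • (rankOneField g x₀ χ hχ b a x).toLinearMap) (T.toFun x) = _
        rw [wedgeDot_add_left, wedgeDot_smul_left, ← hσ, wedgeDot_rankOneField,
          wedgeDot_rankOneField, smul_smul, ← add_smul]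
        congr 1
        ring
      simp only [h2] at h1
      borelize B
      obtain ⟨ν, -, -, hint⟩ := exists_measure_bodyIntegral μ
      simp only [h1, mul_zero]
      rw [hint _ continuous_const, integral_zero]
    refine LinearMap.ext fun u => ?_
    have hd : ∀ v, g.inner x₀ (τ x₀ v) v = 2 * g.inner x₀ (σ x₀ v) v := fun v => by
      obtain ⟨a, rfl⟩ := exists_frame_eq x₀ v
      exact hdiag a
    have hs : ∀ v w, g.inner x₀ (σ x₀ v) w = g.inner x₀ (σ x₀ w) v := fun v w => by
      obtain ⟨a, rfl⟩ := exists_frame_eq x₀ v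
      obtain ⟨b, rfl⟩ := exists_frame_eq x₀ w
      exact hsymm a b
    -- Polarization: the quadratic forms agree at `u + w`, `u` and `w`, and both `τ` and `σ` are
    -- symmetric.
    have hzero : ∀ w, g.inner x₀ (τ x₀ u - (2 : ℝ) • σ x₀ u) w = 0 := fun w => by
      have h1 := hd (u + w)
      simp only [map_add, add_apply] at h1
      rw [map_sub, map_smul]
      change g.inner x₀ (τ x₀ u) w - 2 * g.inner x₀ (σ x₀ u) w = 0
      linarith [hd u, hd w, hs u w, hτ x₀ u w]
    by_contra hne
    exact (g.pos x₀ _ (sub_ne_zero.2 hne)).ne' (hzero _)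
  · intro h c ε hc hc0 hder
    have h1 : ∀ x, hodge g μ x (τ x).toLinearMap = (2 : ℝ) • T.toFun x := fun x => by
      rw [h x, map_smul, LinearEquiv.apply_symm_apply]
    simp only [h1]
    exact hasDerivAt_storedEnergy_strain hU hψ hTf hfStar hc hc0 hder
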